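/- \textbf{Definitions.} For a probability mass function (p.m.f.) $p$ on $\mathbb N_0=\{0,1,2,\dots\}$ let $\mathcal T(p)$ be the circularly symmetric probability law on $\mathbb C$ with density $$\mathcal T(p)(r)=\frac1\pi\sum_{m=0}^\infty p[m]\,\frac{e^{-|r|^2}|r|^{2m}}{m!},\qquad r\in\mathbb C,$$ with respect to Lebesgue measure $d^2r$. For a law $\mu$ on $\mathbb C$ let $$\mathcal T^{-1}(\mu)[k]=\frac1\pi\int_{\mathbb C}\Big(\int_{\mathbb C} e^{r s^*-r^*s}\,d\mu(r)\Big)\,\mathcal L_k(|s|^2)\,d^2s,\qquad k\in\mathbb N_0,$$ where $\mathcal L_k(x)=\sum_{j=0}^k(-1)^j\binom kj\frac{x^j}{j!}$ is the $k$-th Laguerre polynomial. For $\eta_1,\dots,\eta_n\ge 0$ with $\sum_i\eta_i=1$ and random variables $X_1,\dots,X_n$ on $\mathbb N_0$ with p.m.f.s $p_1,\dots,p_n$, the scaled addition $\boxplus_{(\eta_1,\dots,\eta_n)}(X_1,\dots,X_n)$ has p.m.f. $\mathcal T^{-1}(\mu)$, where $\mu$ is the law of $\sum_{i=1}^n\sqrt{\eta_i}\,R_i$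 for independent complex random variables $R_i$ with laws $\mathcal T(p_i)$. \textbf{Theorem.} Let $X_1,X_2,\dots$ be i.i.d. random variables on $\mathbb N_0$ with an arbitrary distribution of finite mean $\lambda$, and for $n\ge1$ let $Y_n=\boxplus_{(\frac1n,\dots,\frac1n)}(X_1,\dots,X_n)$. Then, for every $n\ge 1$, $Y_n$ is well defined: the sequence $p_{Y_n}$ given by the definition above is a p.m.f. on $\mathbb N_0$, and $\mathcal T(p_{Y_n})$ is the law of $\frac1{\sqrt n}\sum_{i=1}^n R_i$, where the $R_i$ are independent complex random variables with common law $\mathcal T(p_{X_1})$. Moreover, the p.m.f. of $Y_n$ converges to the geometric distribution of mean $\lambda$: for every $k\in\mathbb N_0$, $$\lim_{n\to\infty}p_{Y_n}[k]=\frac1{1+\lambda}\Big(\frac{\lambda}{1+\lambda}\Big)^k .$$ -/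

import Mathlib

open MeasureTheory ProbabilityTheory Filter Topology
open scoped BigOperators

noncomputable section

namespace DiscreteEPI

/-- `p : ℕ → ℝ` is a probability mass function on `ℕ₀ = {0, 1, 2, …}`. -/
def IsPMF (p : ℕ → ℝ) : Prop :=
  (∀ k, 0 ≤ p k) ∧ HasSum p 1

/-- The probability mass function `p_X[k] = P(X = k)` of an `ℕ₀`-valued random variable. -/
def pmfOf {Ω : Type*} [MeasurableSpace Ω] (P : Measure Ω) (X : Ω → ℕ) : ℕ → ℝ :=
  fun k => P.real (X ⁻¹' {k})

/-- The Laguerre polynomial `L_n(x) = ∑_{j ≤ n} (-1)^j (n choose j) x^j / j!`. -/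
def laguerre (n : ℕ) (x : ℝ) : ℝ :=
  ∑ j ∈ Finset.range (n + 1), (-1 : ℝ) ^ j * (n.choose j : ℝ) * x ^ j / (j.factorial : ℝ)

/-- The density of the transform `𝒯(p)` of `p` with respect to Lebesgue measure `d²r` on `ℂ`:
`(1/π) ∑_n p[n] e^{-|r|²} |r|^{2n} / n!`. -/
def transformDensity (p : ℕ → ℝ) (r : ℂ) : ℝ :=
  (1 / Real.pi) *
    ∑' n : ℕ, p n * (Real.exp (-‖r‖ ^ 2) * ‖r‖ ^ (2 * n) / (n.factorial : ℝ))

/-- The transform `𝒯(p)`: the law on `ℂ` with density `transformDensity p`. -/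
def transform (p : ℕ → ℝ) : Measure ℂ :=
  volume.withDensity (fun r => ENNReal.ofReal (transformDensity p r))

/-- The (anti-normally ordered) characteristic function `χ(s) = ∫ e^{r s* - r* s} dμ(r)`
of a law `μ` on `ℂ`. -/
def antinormalCharFun (μ : Measure ℂ) (s : ℂ) : ℂ :=
  ∫ r : ℂ, Complex.exp (r * (starRingEnd ℂ) s - (starRingEnd ℂ) r * s) ∂μ

/-- The inverse transform `𝒯⁻¹(μ)`,
`𝒯⁻¹(μ)[n] = (1/π) ∫ (∫ e^{r s* - r* s} dμ(r)) L_n(|s|²) d²s`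
(a real number whenever `μ` is circularly symmetric). -/
def invTransform (μ : Measure ℂ) (n : ℕ) : ℝ :=
  ((1 / Real.pi : ℂ) *
    ∫ s : ℂ, antinormalCharFun μ s * ((laguerre n (‖s‖ ^ 2) : ℝ) : ℂ)).re

/-- The continuous-variable scaled addition: the law of `∑ i, √(η i) Rᵢ`, where the
`Rᵢ` are independent complex random variables with laws `μ i`. -/
def scaledAddLaw {n : ℕ} (η : Fin n → ℝ) (μ : Fin n → Measure ℂ) : Measure ℂ :=
  (Measure.pi μ).map (fun r : Fin n → ℂ => ∑ i, (Real.sqrt (η i) : ℂ) * r i)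

/-- The discrete scaled addition `⊞_η (X_1, …, X_n)` at the level of probability mass functions:
`𝒯⁻¹` of the continuous scaled addition of the `𝒯(p i)`. -/
def scaledAdd {n : ℕ} (η : Fin n → ℝ) (p : Fin n → ℕ → ℝ) : ℕ → ℝ :=
  invTransform (scaledAddLaw η (fun i => transform (p i)))

/-- The geometric distribution on `ℕ₀` with mean `lam`. -/
def geometricPMF (lam : ℝ) (k : ℕ) : ℝ :=
  (1 + lam)⁻¹ * (lam / (1 + lam)) ^ k

end DiscreteEPI

end

/-! Write `fock m` for 𝒯(δ_m). Its characteristic function is L_m(|s|²)e^{-|s|²}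
(`antinormalCharFun_fock`), so 𝒯⁻¹ extracts Laguerre coefficients, and orthogonality gives 𝒯⁻¹𝒯 = id
on p.m.f.s (`invTransform_transform`).

Well-definedness: it must be shown that the normalised sum of the R_i again has a law 𝒯(w). The
orthogonal change of variables R = cx + sy, S = sx - cy turns the joint density of two Fock laws
into a Gaussian times the squared modulus of a homogeneous polynomial in R, S. Integrating out S
kills the cross terms and leaves a nonnegative combination of |R|^{2k}e^{-|R|²}
(`exists_lintegral_fock_fock`). Bilinearity extends this to mixtures, and induction to n summands.

Limit: 𝒯(p) is rotation invariant with E|R|² = 1 + λ, so by the central limit theorem the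
characteristic functions tend to e^{-(1+λ)|s|²} (`tendsto_antinormalCharFun_pow`). The bound
|L_m(x)| ≤ e^{x/2} gives the domination by e^{-|s|²/2}, uniform in n, that lets the limit pass under
𝒯⁻¹; the Laguerre coefficients of the limit are the geometric weights (`integral_laguerre_mul_exp`).
-/

namespace DiscreteEPI

open scoped ENNReal RealInnerProductSpace

/-! ### Gaussian moments on ℂ. -/

lemma integral_norm_pow_mul_exp (k : ℕ) {c : ℝ} (hc : 0 < c) :
    ∫ z : ℂ, ‖z‖ ^ k * Real.exp (-c * ‖z‖ ^ 2) =
      Real.pi * c ^ (-((k : ℝ) + 2) / 2) * Real.Gamma (((k : ℝ) + 2) / 2) := by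
  have h := Complex.integral_rpow_mul_exp_neg_mul_rpow (p := 2) (q := k) (b := c)
    (by norm_num) (by linarith [(Nat.cast_nonneg k : (0 : ℝ) ≤ k)]) hc
  simp only [Real.rpow_natCast, Real.rpow_two] at h
  rw [h]
  ring

lemma integrable_norm_pow_mul_exp (k : ℕ) {c : ℝ} (hc : 0 < c) :
    Integrable (fun z : ℂ => ‖z‖ ^ k * Real.exp (-c * ‖z‖ ^ 2)) := by
  -- A non-integrable function has Bochner integral 0 by convention, so the nonzero value just
  -- computed proves integrability.
  refine Integrable.of_integral_ne_zero ?_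
  rw [integral_norm_pow_mul_exp k hc]
  have : 0 < Real.Gamma (((k : ℝ) + 2) / 2) := Real.Gamma_pos_of_pos (by positivity)
  positivity

lemma integral_norm_even_pow_mul_exp (k : ℕ) {c : ℝ} (hc : 0 < c) :
    ∫ z : ℂ, ‖z‖ ^ (2 * k) * Real.exp (-c * ‖z‖ ^ 2) =
      Real.pi * k.factorial / c ^ (k + 1) := by
  rw [integral_norm_pow_mul_exp _ hc]
  have h1 : (((2 * k : ℕ) : ℝ) + 2) / 2 = (k : ℝ) + 1 := by push_cast; ring
  rw [neg_div, h1, Real.Gamma_nat_eq_factorial, Real.rpow_neg hc.le]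
  have h2 : c ^ ((k : ℝ) + 1) = c ^ (k + 1) := by exact_mod_cast Real.rpow_natCast c (k + 1)
  rw [h2]
  ring

lemma integral_norm_even_pow_mul_exp_neg (k : ℕ) :
    ∫ z : ℂ, ‖z‖ ^ (2 * k) * Real.exp (-‖z‖ ^ 2) = Real.pi * k.factorial := by
  simpa using integral_norm_even_pow_mul_exp k one_pos

lemma integrable_norm_pow_mul_exp_neg (k : ℕ) :
    Integrable (fun z : ℂ => ‖z‖ ^ k * Real.exp (-‖z‖ ^ 2)) := by
  simpa using integrable_norm_pow_mul_exp k one_pos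

/-- The Gaussian monomial `z ^ i * conj z ^ j * exp (-|z|²)`. -/
noncomputable def gaussMonomial (i j : ℕ) (z : ℂ) : ℂ :=
  z ^ i * (starRingEnd ℂ z) ^ j * (Real.exp (-‖z‖ ^ 2) : ℝ)

lemma continuous_gaussMonomial (i j : ℕ) : Continuous (gaussMonomial i j) := by
  unfold gaussMonomial
  have := Complex.continuous_conj
  fun_prop

lemma norm_gaussMonomial (i j : ℕ) (z : ℂ) :
    ‖gaussMonomial i j z‖ = ‖z‖ ^ (i + j) * Real.exp (-‖z‖ ^ 2) := by
  simp only [gaussMonomial, norm_mul, norm_pow, RCLike.norm_conj, Complex.norm_real,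
    Real.norm_eq_abs, Real.abs_exp, pow_add]

lemma integrable_gaussMonomial (i j : ℕ) : Integrable (gaussMonomial i j) :=
  (integrable_norm_pow_mul_exp_neg (i + j)).mono'
    (continuous_gaussMonomial i j).aestronglyMeasurable
    (Eventually.of_forall fun z => (norm_gaussMonomial i j z).le)

lemma integral_gaussMonomial_self (i : ℕ) :
    ∫ z, gaussMonomial i i z = Real.pi * i.factorial := by
  have h : ∀ z, gaussMonomial i i z =
      ((‖z‖ ^ (2 * i) * Real.exp (-‖z‖ ^ 2) : ℝ) : ℂ) := by
    intro z
    rw [gaussMonomial, ← mul_pow, Complex.mul_conj, Complex.normSq_eq_norm_sq, pow_mul]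
    push_cast
    ring
  simp_rw [h]
  rw [integral_complex_ofReal, integral_norm_even_pow_mul_exp_neg]
  push_cast
  ring

lemma integral_gaussMonomial_of_ne {i j : ℕ} (hij : i ≠ j) :
    ∫ z, gaussMonomial i j z = 0 := by
  have hd : (i : ℂ) - j ≠ 0 := sub_ne_zero.mpr (by exact_mod_cast hij)
  -- Rotation by this angle multiplies the monomial by e^{i(i-j)t} = -1 and preserves Lebesgue
  -- measure, so the integral equals its own negative.
  set t : ℝ := Real.pi / ((i : ℝ) - j) with ht
  set u : Circle := Circle.exp t with hu
  have hmp : MeasurePreserving (rotation u) (volume : Measure ℂ) volume :=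
    LinearIsometryEquiv.measurePreserving (rotation u)
  have h1 : ∀ z, gaussMonomial i j (rotation u z) = - gaussMonomial i j z := by
    intro z
    have h2 : ((u : ℂ)) ^ i * (starRingEnd ℂ (u : ℂ)) ^ j = -1 := by
      rw [hu, Circle.coe_exp, ← Complex.exp_conj, ← Complex.exp_nat_mul, ← Complex.exp_nat_mul,
        ← Complex.exp_add, ← Complex.exp_pi_mul_I]
      congr 1
      simp only [map_mul, Complex.conj_ofReal, Complex.conj_I, ht]
      push_cast
      field_simp
      ring
    have h3 : ‖rotation u z‖ = ‖z‖ := LinearIsometryEquiv.norm_map _ _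
    simp only [gaussMonomial, h3]
    rw [rotation_apply, map_mul, mul_pow, mul_pow]
    linear_combination (z ^ i * (starRingEnd ℂ z) ^ j * (Real.exp (-‖z‖ ^ 2) : ℝ)) * h2
  have h4 := hmp.integral_comp (rotation u).toHomeomorph.measurableEmbedding (gaussMonomial i j)
  simp_rw [h1] at h4
  rw [integral_neg] at h4
  exact self_eq_neg.mp h4.symm

lemma integral_gaussMonomial (i j : ℕ) :
    ∫ z, gaussMonomial i j z = if i = j then (Real.pi * i.factorial : ℂ) else 0 := by
  split_ifs with h
  · rw [h, integral_gaussMonomial_self]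
  · exact integral_gaussMonomial_of_ne h

/-! ### Exponentials integrated against Gaussian monomials. -/

lemma hasSum_pow_div_factorial (x : ℝ) :
    HasSum (fun k : ℕ => x ^ k / (k.factorial : ℝ)) (Real.exp x) := by
  rw [Real.exp_eq_exp_ℝ]
  exact NormedSpace.expSeries_div_hasSum_exp x

lemma hasSum_complex_pow_div_factorial (x : ℂ) :
    HasSum (fun k : ℕ => x ^ k / (k.factorial : ℂ)) (Complex.exp x) := by
  rw [Complex.exp_eq_exp_ℂ]
  exact NormedSpace.expSeries_div_hasSum_exp x

lemma hasSum_mul_prod {f g : ℕ → ℂ} {a b : ℂ} (hf : HasSum f a) (hg : HasSum g b) :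
    HasSum (fun kl : ℕ × ℕ => f kl.1 * g kl.2) (a * b) :=
  hf.mul hg (summable_mul_of_summable_norm (f := f) (g := g) hf.summable.norm hg.summable.norm)

lemma integrable_exp_mul_norm_pow_mul_exp (k : ℕ) (c : ℝ) :
    Integrable (fun z : ℂ => Real.exp (c * ‖z‖) * (‖z‖ ^ k * Real.exp (-‖z‖ ^ 2))) := by
  refine ((integrable_norm_pow_mul_exp k (c := 1 / 2) (by norm_num)).const_mul
    (Real.exp (c ^ 2 / 2))).mono' (by fun_prop) (Eventually.of_forall fun z => ?_)
  rw [Real.norm_of_nonneg (by positivity)]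
  have h : Real.exp (c * ‖z‖) * Real.exp (-‖z‖ ^ 2) ≤
      Real.exp (c ^ 2 / 2) * Real.exp (-(1 / 2) * ‖z‖ ^ 2) := by
    rw [← Real.exp_add, ← Real.exp_add]
    exact Real.exp_le_exp.mpr (by nlinarith [sq_nonneg (c - ‖z‖)])
  calc _ = ‖z‖ ^ k * (Real.exp (c * ‖z‖) * Real.exp (-‖z‖ ^ 2)) := by ring
    _ ≤ ‖z‖ ^ k * (Real.exp (c ^ 2 / 2) * Real.exp (-(1 / 2) * ‖z‖ ^ 2)) := by gcongr
    _ = _ := by ring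

lemma integrable_exp_mul_gaussMonomial (a b : ℂ) (i j : ℕ) :
    Integrable (fun z : ℂ => Complex.exp (a * z + b * starRingEnd ℂ z) * gaussMonomial i j z) := by
  have := continuous_gaussMonomial i j
  have := Complex.continuous_conj
  refine (integrable_exp_mul_norm_pow_mul_exp (i + j) (‖a‖ + ‖b‖)).mono'
    (Continuous.aestronglyMeasurable (by fun_prop)) (Eventually.of_forall fun z => ?_)
  rw [norm_mul, norm_gaussMonomial, Complex.norm_exp]
  gcongr
  refine (Complex.re_le_norm _).trans ((norm_add_le _ _).trans (le_of_eq ?_))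
  rw [norm_mul, norm_mul, RCLike.norm_conj]
  ring

/-- Termwise integration of the exponential series against a Gaussian monomial. -/
lemma hasSum_integral_exp_mul_gaussMonomial (a b : ℂ) (i j : ℕ) :
    HasSum (fun kl : ℕ × ℕ => a ^ kl.1 / (kl.1.factorial : ℂ) * (b ^ kl.2 / (kl.2.factorial : ℂ)) *
        ∫ z, gaussMonomial (kl.1 + i) (kl.2 + j) z)
      (∫ z : ℂ, Complex.exp (a * z + b * starRingEnd ℂ z) * gaussMonomial i j z) := by
  have hterm : ∀ (kl : ℕ × ℕ) (z : ℂ),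
      (a * z) ^ kl.1 / (kl.1.factorial : ℂ) *
        ((b * starRingEnd ℂ z) ^ kl.2 / (kl.2.factorial : ℂ)) * gaussMonomial i j z =
      a ^ kl.1 / (kl.1.factorial : ℂ) * (b ^ kl.2 / (kl.2.factorial : ℂ)) *
        gaussMonomial (kl.1 + i) (kl.2 + j) z := by
    intro kl z
    simp only [gaussMonomial, mul_pow, pow_add]
    ring
  have hb : ∀ z : ℂ, HasSum (fun kl : ℕ × ℕ => (‖a‖ * ‖z‖) ^ kl.1 / (kl.1.factorial : ℝ) *
        ((‖b‖ * ‖z‖) ^ kl.2 / (kl.2.factorial : ℝ)) * (‖z‖ ^ (i + j) * Real.exp (-‖z‖ ^ 2)))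
      (Real.exp ((‖a‖ + ‖b‖) * ‖z‖) * (‖z‖ ^ (i + j) * Real.exp (-‖z‖ ^ 2))) := by
    intro z
    refine HasSum.mul_right _ ?_
    rw [add_mul, Real.exp_add]
    have h1 := hasSum_pow_div_factorial (‖a‖ * ‖z‖)
    have h2 := hasSum_pow_div_factorial (‖b‖ * ‖z‖)
    exact h1.mul h2 (h1.summable.mul_of_nonneg h2.summable (fun k => by positivity)
      (fun k => by positivity))
  have key := hasSum_integral_of_dominated_convergence (μ := (volume : Measure ℂ))
    (F := fun (kl : ℕ × ℕ) (z : ℂ) => (a * z) ^ kl.1 / (kl.1.factorial : ℂ) *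
        ((b * starRingEnd ℂ z) ^ kl.2 / (kl.2.factorial : ℂ)) * gaussMonomial i j z)
    (f := fun z : ℂ => Complex.exp (a * z + b * starRingEnd ℂ z) * gaussMonomial i j z)
    (fun (kl : ℕ × ℕ) (z : ℂ) => (‖a‖ * ‖z‖) ^ kl.1 / (kl.1.factorial : ℝ) *
        ((‖b‖ * ‖z‖) ^ kl.2 / (kl.2.factorial : ℝ)) * (‖z‖ ^ (i + j) * Real.exp (-‖z‖ ^ 2)))
    ?_ ?_ ?_ ?_ ?_
  · simp_rw [hterm, integral_const_mul] at key
    exact key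
  · intro kl
    have := continuous_gaussMonomial i j
    have := Complex.continuous_conj
    exact Continuous.aestronglyMeasurable (by fun_prop)
  · refine fun kl => Eventually.of_forall fun z => le_of_eq ?_
    simp [norm_gaussMonomial]
  · exact Eventually.of_forall fun z => (hb z).summable
  · simp_rw [fun z => (hb z).tsum_eq]
    exact integrable_exp_mul_norm_pow_mul_exp _ _
  · refine Eventually.of_forall fun z => ?_
    have h := (hasSum_mul_prod (hasSum_complex_pow_div_factorial (a * z))
      (hasSum_complex_pow_div_factorial (b * starRingEnd ℂ z))).mul_right (gaussMonomial i j z)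
    rw [← Complex.exp_add] at h
    exact h

lemma integral_exp_mul_gaussMonomial (a : ℂ) {i j : ℕ} (hij : i ≤ j) :
    ∫ z : ℂ, Complex.exp (a * z) * gaussMonomial i j z =
      a ^ (j - i) / ((j - i).factorial : ℂ) * (Real.pi * j.factorial) := by
  have h := hasSum_integral_exp_mul_gaussMonomial a 0 i j
  simp only [zero_mul, add_zero] at h
  refine h.unique ?_
  -- Since 0 ^ 0 = 1, the terms with l = 0 remain; among them orthogonality of the monomials selects
  -- k = j - i.
  have h2 := hasSum_single (f := fun kl : ℕ × ℕ => a ^ kl.1 / (kl.1.factorial : ℂ) *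
    (0 ^ kl.2 / (kl.2.factorial : ℂ)) * ∫ z, gaussMonomial (kl.1 + i) (kl.2 + j) z)
    ((j - i, 0) : ℕ × ℕ) ?_
  · simpa [integral_gaussMonomial, hij] using h2
  · rintro ⟨k, l⟩ hkl
    rcases Nat.eq_zero_or_pos l with rfl | hl
    · have : k + i ≠ 0 + j := fun h => hkl (by simp; omega)
      simp only [integral_gaussMonomial_of_ne this, mul_zero]
    · simp [hl.ne']

/-! ### Orthogonality of Laguerre polynomials. -/

lemma fwdDiff_iter_choose_of_le {j m : ℕ} (h : j ≤ m) (y : ℕ) :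
    (fwdDiff 1)^[m] (fun x : ℕ => (x.choose j : ℤ)) y = if j = m then 1 else 0 := by
  obtain ⟨d, rfl⟩ := Nat.exists_eq_add_of_le' h
  rw [Function.iterate_add_apply]
  have h1 : (fwdDiff 1)^[j] (fun x : ℕ => (x.choose j : ℤ)) = fun _ => 1 := by
    simpa using fwdDiff_iter_choose 0 j
  rw [h1]
  cases d with
  | zero => simp
  | succ d =>
    rw [Function.iterate_succ_apply, fwdDiff_const]
    simp [fwdDiff_iter_eq_sum_shift]

/-- Up to the sign (-1)^m, the sum is the m-th forward difference at j of x ↦ (x choose j), a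
polynomial of degree j ≤ m. -/
lemma sum_neg_one_pow_mul_choose_mul_choose {j m : ℕ} (h : j ≤ m) :
    ∑ i ∈ Finset.range (m + 1), (-1 : ℝ) ^ i * (m.choose i : ℝ) * ((i + j).choose j : ℝ) =
      if j = m then (-1) ^ m else 0 := by
  have h1 := fwdDiff_iter_choose_of_le h j
  rw [fwdDiff_iter_eq_sum_shift] at h1
  have h2 : ∑ i ∈ Finset.range (m + 1),
      (-1 : ℝ) ^ (m - i) * (m.choose i : ℝ) * ((i + j).choose j : ℝ) =
      if j = m then 1 else 0 := by
    have := congrArg (Int.cast : ℤ → ℝ) h1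
    push_cast at this
    simpa [add_comm j] using this
  have h3 := congrArg (fun t : ℝ => (-1) ^ m * t) h2
  simp only [Finset.mul_sum, mul_ite, mul_one, mul_zero] at h3
  rw [← h3]
  refine Finset.sum_congr rfl fun i hi => ?_
  have hi' : i ≤ m := Nat.lt_succ_iff.mp (Finset.mem_range.mp hi)
  obtain ⟨d, rfl⟩ := Nat.exists_eq_add_of_le hi'
  have : (-1 : ℝ) ^ (i + d) * (-1) ^ (i + d - i) = (-1) ^ i := by
    rw [Nat.add_sub_cancel_left, pow_add, mul_assoc, ← mul_pow]
    simp
  rw [← mul_assoc, ← mul_assoc, this]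

lemma laguerre_mul_laguerre (m n : ℕ) (x : ℝ) :
    laguerre m x * laguerre n x = ∑ i ∈ Finset.range (m + 1), ∑ j ∈ Finset.range (n + 1),
      ((-1 : ℝ) ^ i * m.choose i / i.factorial) * ((-1 : ℝ) ^ j * n.choose j / j.factorial) *
        x ^ (i + j) := by
  rw [laguerre, laguerre, Finset.sum_mul_sum]
  refine Finset.sum_congr rfl fun i _ => Finset.sum_congr rfl fun j _ => ?_
  rw [pow_add]
  ring

lemma integrable_pow_normSq_mul_exp (k : ℕ) :
    Integrable (fun s : ℂ => (‖s‖ ^ 2) ^ k * Real.exp (-‖s‖ ^ 2)) := by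
  simp_rw [← pow_mul]
  exact integrable_norm_pow_mul_exp_neg _

lemma integrable_laguerre_mul_laguerre (m n : ℕ) :
    Integrable (fun s : ℂ => laguerre m (‖s‖ ^ 2) * laguerre n (‖s‖ ^ 2) *
      Real.exp (-‖s‖ ^ 2)) := by
  simp_rw [laguerre_mul_laguerre, Finset.sum_mul, mul_assoc]
  refine integrable_finsetSum _ fun i _ => integrable_finsetSum _ fun j _ => ?_
  have := (integrable_pow_normSq_mul_exp (i + j)).const_mul
    (((-1 : ℝ) ^ i * m.choose i / i.factorial) * ((-1 : ℝ) ^ j * n.choose j / j.factorial))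
  simpa only [mul_assoc] using this

/-- The moment (i+j)! combines with 1/(i! j!) into a binomial coefficient, so the sum over i is a
finite difference that vanishes unless j = m. As j ≤ n ≤ m, this requires n = m. -/
lemma integral_laguerre_mul_laguerre_of_le {m n : ℕ} (h : n ≤ m) :
    ∫ s : ℂ, laguerre m (‖s‖ ^ 2) * laguerre n (‖s‖ ^ 2) * Real.exp (-‖s‖ ^ 2) =
      if m = n then Real.pi else 0 := by
  simp_rw [laguerre_mul_laguerre, Finset.sum_mul, mul_assoc _ (_ ^ _) (Real.exp _)]
  rw [integral_finsetSum _ fun i _ => integrable_finsetSum _ fun j _ =>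
    (integrable_pow_normSq_mul_exp (i + j)).const_mul _]
  simp_rw [integral_finsetSum (Finset.range (n + 1)) fun j _ =>
    (integrable_pow_normSq_mul_exp (_ + j)).const_mul _, integral_const_mul, ← pow_mul,
    integral_norm_even_pow_mul_exp_neg]
  rw [Finset.sum_comm]
  have h1 : ∀ i j : ℕ, ((-1 : ℝ) ^ i * m.choose i / i.factorial) *
      ((-1 : ℝ) ^ j * n.choose j / j.factorial) * (Real.pi * (i + j).factorial) =
      Real.pi * ((-1 : ℝ) ^ j * n.choose j) *
        ((-1 : ℝ) ^ i * (m.choose i : ℝ) * ((i + j).choose j : ℝ)) := by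
    intro i j
    have h2 : (((i + j).choose j * i.factorial * j.factorial : ℕ) : ℝ) = (i + j).factorial := by
      rw [Nat.add_choose_mul_factorial_mul_factorial]
    rw [← h2]
    push_cast
    field_simp
  simp_rw [h1, ← Finset.mul_sum]
  have h3 : ∀ j ∈ Finset.range (n + 1), Real.pi * ((-1 : ℝ) ^ j * n.choose j) *
      ∑ i ∈ Finset.range (m + 1), ((-1 : ℝ) ^ i * (m.choose i : ℝ) * ((i + j).choose j : ℝ)) =
      if j = m then Real.pi * ((-1 : ℝ) ^ m * n.choose m) * (-1) ^ m else 0 := by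
    intro j hj
    rw [sum_neg_one_pow_mul_choose_mul_choose
      ((Nat.lt_succ_iff.mp (Finset.mem_range.mp hj)).trans h)]
    split_ifs with hjm
    · rw [hjm]
    · simp
  rw [Finset.sum_congr rfl h3, Finset.sum_ite_eq']
  rcases h.eq_or_lt with rfl | hlt
  · have : (-1 : ℝ) ^ n * (-1) ^ n = 1 := by rw [← mul_pow]; simp
    simp [mul_assoc, this]
  · rw [if_neg (by simpa using hlt), if_neg hlt.ne']

lemma integral_laguerre_mul_laguerre (m n : ℕ) :
    ∫ s : ℂ, laguerre m (‖s‖ ^ 2) * laguerre n (‖s‖ ^ 2) * Real.exp (-‖s‖ ^ 2) =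
      if m = n then Real.pi else 0 := by
  rcases le_total n m with h | h
  · exact integral_laguerre_mul_laguerre_of_le h
  · simp_rw [mul_comm (laguerre m _)]
    rw [integral_laguerre_mul_laguerre_of_le h]
    simp [eq_comm]

/-- From 2|ab| ≤ a² + b² and the two norms. Uniformity in m justifies exchanging sum and integral in
`invTransform_transform`. -/
lemma integral_norm_laguerre_mul_laguerre_le (m n : ℕ) :
    ∫ s : ℂ, ‖laguerre m (‖s‖ ^ 2) * laguerre n (‖s‖ ^ 2) * Real.exp (-‖s‖ ^ 2)‖ ≤ Real.pi := by
  calc _ ≤ ∫ s : ℂ, (1 / 2 : ℝ) *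
        (laguerre m (‖s‖ ^ 2) * laguerre m (‖s‖ ^ 2) * Real.exp (-‖s‖ ^ 2) +
          laguerre n (‖s‖ ^ 2) * laguerre n (‖s‖ ^ 2) * Real.exp (-‖s‖ ^ 2)) := by
        refine integral_mono (integrable_laguerre_mul_laguerre m n).norm
          (((integrable_laguerre_mul_laguerre m m).add
            (integrable_laguerre_mul_laguerre n n)).const_mul _) fun s => ?_
        simp only [norm_mul, Real.norm_eq_abs, Real.abs_exp]
        rw [← add_mul, ← mul_assoc]
        refine mul_le_mul_of_nonneg_right ?_ (Real.exp_pos _).le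
        rw [← abs_mul_abs_self (laguerre m _), ← abs_mul_abs_self (laguerre n _)]
        nlinarith [sq_nonneg (|laguerre m (‖s‖ ^ 2)| - |laguerre n (‖s‖ ^ 2)|)]
    _ = Real.pi := by
        rw [integral_const_mul, integral_add (integrable_laguerre_mul_laguerre m m)
          (integrable_laguerre_mul_laguerre n n), integral_laguerre_mul_laguerre,
          integral_laguerre_mul_laguerre]
        simp only [if_true]
        ring

/-! ### The exponential bound and the Kummer transformation for Laguerre polynomials. -/

/-- Represents L_m(s²) as a Gaussian inner product of z^m with its displaced copy e^{sz}(z - s)^m,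
so that a Cauchy-Schwarz type estimate can bound it. -/
lemma integral_exp_mul_sub_pow_mul_gaussMonomial (s : ℝ) (m : ℕ) :
    ∫ z : ℂ, Complex.exp (s * z) * (z - s) ^ m * gaussMonomial 0 m z =
      Real.pi * m.factorial * (laguerre m (s ^ 2) : ℝ) := by
  have h1 : ∀ z : ℂ, Complex.exp (s * z) * (z - s) ^ m * gaussMonomial 0 m z =
      ∑ j ∈ Finset.range (m + 1), ((-s : ℂ) ^ (m - j) * m.choose j) *
        (Complex.exp (s * z) * gaussMonomial j m z) := by
    intro z
    rw [sub_eq_add_neg, add_pow, Finset.mul_sum, Finset.sum_mul]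
    refine Finset.sum_congr rfl fun j _ => ?_
    simp only [gaussMonomial]
    ring
  have hint : ∀ j, Integrable fun z : ℂ => Complex.exp (s * z) * gaussMonomial j m z := fun j => by
    simpa using integrable_exp_mul_gaussMonomial s 0 j m
  simp_rw [h1]
  rw [integral_finsetSum _ fun j _ => (hint j).const_mul _]
  simp_rw [integral_const_mul]
  rw [laguerre, ← Finset.sum_range_reflect]
  push_cast
  rw [Finset.mul_sum]
  refine Finset.sum_congr rfl fun j hj => ?_
  have hj' : j ≤ m := Nat.lt_succ_iff.mp (Finset.mem_range.mp hj)
  rw [integral_exp_mul_gaussMonomial _ (Nat.sub_le m j), Nat.choose_symm hj',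
    Nat.sub_sub_self hj', neg_pow]
  ring

/-- In the inner product representation, completing the square makes the modulus of the integrand
e^{s²/2}AB, where A² and its translate B² both have integral π m!. Then AB ≤ (A² + B²)/2 suffices.
-/
lemma abs_laguerre_sq_le (m : ℕ) (s : ℝ) : |laguerre m (s ^ 2)| ≤ Real.exp (s ^ 2 / 2) := by
  have h1 := integral_exp_mul_sub_pow_mul_gaussMonomial s m
  have hg : Integrable fun z : ℂ => ‖z‖ ^ (2 * m) * Real.exp (-‖z‖ ^ 2) :=
    integrable_norm_pow_mul_exp_neg _
  have hg' : Integrable fun z : ℂ => ‖z - s‖ ^ (2 * m) * Real.exp (-‖z - s‖ ^ 2) :=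
    hg.comp_sub_right (s : ℂ)
  have h2 : ‖∫ z : ℂ, Complex.exp (s * z) * (z - s) ^ m * gaussMonomial 0 m z‖ ≤
      ∫ z : ℂ, Real.exp (s ^ 2 / 2) / 2 * (‖z‖ ^ (2 * m) * Real.exp (-‖z‖ ^ 2) +
        ‖z - s‖ ^ (2 * m) * Real.exp (-‖z - s‖ ^ 2)) := by
    refine norm_integral_le_of_norm_le ((hg.add hg').const_mul _)
      (Eventually.of_forall fun z => ?_)
    rw [norm_mul, norm_mul, norm_gaussMonomial, norm_pow, Complex.norm_exp, zero_add]
    set A := ‖z‖ ^ m * Real.exp (-‖z‖ ^ 2 / 2) with hA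
    set B := ‖z - s‖ ^ m * Real.exp (-‖z - s‖ ^ 2 / 2) with hB
    have hns : ‖z - s‖ ^ 2 = ‖z‖ ^ 2 - 2 * (s * z.re) + s ^ 2 := by
      rw [← Complex.normSq_eq_norm_sq, ← Complex.normSq_eq_norm_sq, Complex.normSq_apply,
        Complex.normSq_apply]
      simp
      ring
    have e1 : Real.exp ((s : ℂ) * z).re * ‖z - s‖ ^ m * (‖z‖ ^ m * Real.exp (-‖z‖ ^ 2)) =
        Real.exp (s ^ 2 / 2) * (A * B) := by
      have : Real.exp ((s : ℂ) * z).re * Real.exp (-‖z‖ ^ 2) = Real.exp (s ^ 2 / 2) *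
          (Real.exp (-‖z‖ ^ 2 / 2) * Real.exp (-‖z - s‖ ^ 2 / 2)) := by
        rw [← Real.exp_add, ← Real.exp_add, ← Real.exp_add, hns]
        congr 1
        simp
        ring
      rw [hA, hB]
      linear_combination (‖z - s‖ ^ m * ‖z‖ ^ m) * this
    have e2 : ‖z‖ ^ (2 * m) * Real.exp (-‖z‖ ^ 2) = A ^ 2 := by
      rw [hA, mul_pow, ← Real.exp_nat_mul, ← pow_mul, mul_comm m 2]
      congr 2
      push_cast
      ring
    have e3 : ‖z - s‖ ^ (2 * m) * Real.exp (-‖z - s‖ ^ 2) = B ^ 2 := by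
      rw [hB, mul_pow, ← Real.exp_nat_mul, ← pow_mul, mul_comm m 2]
      congr 2
      push_cast
      ring
    rw [e1, e2, e3]
    have := Real.exp_pos (s ^ 2 / 2)
    nlinarith [mul_nonneg this.le (sq_nonneg (A - B))]
  have hshift : ∫ z : ℂ, ‖z - s‖ ^ (2 * m) * Real.exp (-‖z - s‖ ^ 2) =
      Real.pi * m.factorial := by
    rw [integral_sub_right_eq_self (fun z : ℂ => ‖z‖ ^ (2 * m) * Real.exp (-‖z‖ ^ 2)) (s : ℂ),
      integral_norm_even_pow_mul_exp_neg]
  rw [h1, integral_const_mul, integral_add hg hg', hshift,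
    integral_norm_even_pow_mul_exp_neg] at h2
  have hpos : (0 : ℝ) < Real.pi * m.factorial := by positivity
  have h3 : ‖(Real.pi * m.factorial * (laguerre m (s ^ 2) : ℝ) : ℂ)‖ =
      Real.pi * m.factorial * |laguerre m (s ^ 2)| := by
    rw [← Complex.ofReal_natCast, ← Complex.ofReal_mul, ← Complex.ofReal_mul, Complex.norm_real,
      Real.norm_eq_abs, abs_mul, abs_of_pos hpos]
  rw [h3] at h2
  refine le_of_mul_le_mul_left (h2.trans (le_of_eq ?_)) hpos
  ring

lemma hasSum_laguerre (m : ℕ) (x : ℝ) :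
    HasSum (fun j : ℕ => (-1 : ℝ) ^ j * (m.choose j : ℝ) * x ^ j / (j.factorial : ℝ))
      (laguerre m x) := by
  refine hasSum_sum_of_ne_finset_zero fun j hj => ?_
  rw [Nat.choose_eq_zero_of_lt (by simpa using hj)]
  simp

/-- The Kummer transformation for Laguerre polynomials. -/
lemma hasSum_laguerre_mul_exp_neg (m : ℕ) (x : ℝ) :
    HasSum (fun k : ℕ => (-x) ^ k / (k.factorial : ℝ) * ((m + k).choose k : ℝ))
      (laguerre m x * Real.exp (-x)) := by
  have hL := hasSum_laguerre m x
  have hE := hasSum_pow_div_factorial (-x)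
  have h1 := (summable_norm_sum_mul_antidiagonal_of_summable_norm hL.summable.norm
    hE.summable.norm).of_norm.hasSum
  rw [← tsum_mul_tsum_eq_tsum_sum_antidiagonal_of_summable_norm hL.summable.norm hE.summable.norm,
    hL.tsum_eq, hE.tsum_eq] at h1
  convert! h1 using 1
  funext k
  -- Vandermonde's identity matches the coefficient with the Cauchy product of the two series.
  rw [Nat.add_choose_eq, Nat.cast_sum, Finset.mul_sum]
  refine Finset.sum_congr rfl fun ij hij => ?_
  obtain ⟨i, j⟩ := ij
  obtain rfl : i + j = k := Finset.HasAntidiagonal.mem_antidiagonal.mp hij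
  simp only
  have h2 : (((i + j).choose j * i.factorial * j.factorial : ℕ) : ℝ) = (i + j).factorial := by
    rw [Nat.add_choose_mul_factorial_mul_factorial]
  rw [← h2]
  have h3 : ((i + j).choose j : ℝ) ≠ 0 := by
    exact_mod_cast (Nat.choose_pos (Nat.le_add_left j i)).ne'
  push_cast
  rw [neg_pow, neg_pow x j, pow_add, pow_add]
  field_simp

lemma integral_exp_mul_gaussMonomial_self (m : ℕ) (s : ℂ) :
    ∫ z : ℂ, Complex.exp (starRingEnd ℂ s * z + (-s) * starRingEnd ℂ z) * gaussMonomial m m z =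
      Real.pi * m.factorial * ((laguerre m (‖s‖ ^ 2) * Real.exp (-‖s‖ ^ 2) : ℝ) : ℂ) := by
  have h := hasSum_integral_exp_mul_gaussMonomial (starRingEnd ℂ s) (-s) m m
  -- Orthogonality leaves only the diagonal terms k = l, and these form the Kummer series.
  have hinj : Function.Injective fun k : ℕ => (k, k) := fun a b hab => congrArg Prod.fst hab
  rw [← hinj.hasSum_iff] at h
  · refine h.unique ?_
    have h2 := ((Complex.hasSum_ofReal.mpr (hasSum_laguerre_mul_exp_neg m (‖s‖ ^ 2))).mul_left
      (Real.pi * m.factorial : ℂ))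
    convert! h2 using 1
    funext k
    have h3 : (((m + k).choose k * m.factorial * k.factorial : ℕ) : ℂ) = (m + k).factorial := by
      rw [Nat.add_choose_mul_factorial_mul_factorial]
    have h4 : starRingEnd ℂ s ^ k * (-s) ^ k = (-(‖s‖ : ℂ) ^ 2) ^ k := by
      rw [← mul_pow, mul_neg, mul_comm, Complex.mul_conj, Complex.normSq_eq_norm_sq]
      push_cast
      rfl
    simp only [Function.comp_apply, integral_gaussMonomial_self]
    rw [add_comm k m, ← h3]
    push_cast
    rw [← h4]
    have : (k.factorial : ℂ) ≠ 0 := by exact_mod_cast k.factorial_ne_zero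
    field_simp
  · rintro ⟨k, l⟩ hkl
    have : k + m ≠ l + m := fun h => hkl ⟨k, by simp; omega⟩
    simp only [integral_gaussMonomial_of_ne this, mul_zero]

/-! ### Fock laws and their mixtures. -/

/-- The density of the law `𝒯(δ_m)`. -/
noncomputable def fockDensity (m : ℕ) (r : ℂ) : ℝ :=
  Real.pi⁻¹ * (Real.exp (-‖r‖ ^ 2) * ‖r‖ ^ (2 * m) / (m.factorial : ℝ))

/-- The law `𝒯(δ_m)` on `ℂ`. -/
noncomputable def fock (m : ℕ) : Measure ℂ :=
  volume.withDensity fun r => ENNReal.ofReal (fockDensity m r)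

lemma fockDensity_nonneg (m : ℕ) (r : ℂ) : 0 ≤ fockDensity m r := by
  unfold fockDensity
  positivity

lemma continuous_fockDensity (m : ℕ) : Continuous (fockDensity m) := by
  unfold fockDensity
  fun_prop

lemma measurable_ofReal_fockDensity (m : ℕ) :
    Measurable fun r => ENNReal.ofReal (fockDensity m r) :=
  (continuous_fockDensity m).measurable.ennreal_ofReal

lemma integrable_fockDensity (m : ℕ) : Integrable (fockDensity m) := by
  refine ((integrable_norm_pow_mul_exp_neg (2 * m)).const_mul
    (Real.pi⁻¹ / m.factorial)).congr (Eventually.of_forall fun r => ?_)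
  simp only [fockDensity]
  ring

lemma integral_fockDensity (m : ℕ) : ∫ r, fockDensity m r = 1 := by
  have h : ∀ r, fockDensity m r =
      Real.pi⁻¹ / m.factorial * (‖r‖ ^ (2 * m) * Real.exp (-‖r‖ ^ 2)) := fun r => by
    simp only [fockDensity]
    ring
  simp_rw [h]
  rw [integral_const_mul, integral_norm_even_pow_mul_exp_neg]
  have := Real.pi_pos.ne'
  field_simp

instance isProbabilityMeasure_fock (m : ℕ) : IsProbabilityMeasure (fock m) := by
  constructor
  rw [fock, withDensity_apply _ MeasurableSet.univ, Measure.restrict_univ,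
    ← ofReal_integral_eq_lintegral_ofReal (integrable_fockDensity m)
      (Eventually.of_forall (fockDensity_nonneg m)), integral_fockDensity, ENNReal.ofReal_one]

lemma lintegral_fock (m : ℕ) (φ : ℂ → ℝ≥0∞) :
    ∫⁻ r, φ r ∂fock m = ∫⁻ r, ENNReal.ofReal (fockDensity m r) * φ r :=
  lintegral_withDensity_eq_lintegral_mul_non_measurable _ (measurable_ofReal_fockDensity m)
    (Eventually.of_forall fun _ => ENNReal.ofReal_lt_top) φ

/-- The mixture `∑ m, W m • 𝒯(δ_m)`. -/
noncomputable def mixture (W : ℕ → ℝ≥0∞) : Measure ℂ :=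
  Measure.sum fun m => W m • fock m

instance sFinite_mixture (W : ℕ → ℝ≥0∞) : SFinite (mixture W) := by
  unfold mixture
  infer_instance

lemma lintegral_mixture (W : ℕ → ℝ≥0∞) (φ : ℂ → ℝ≥0∞) :
    ∫⁻ r, φ r ∂mixture W = ∑' m, W m * ∫⁻ r, φ r ∂fock m := by
  rw [mixture, lintegral_sum_measure]
  simp_rw [lintegral_smul_measure, smul_eq_mul]

lemma mixture_univ (W : ℕ → ℝ≥0∞) : mixture W Set.univ = ∑' m, W m := by
  rw [← lintegral_one, lintegral_mixture]
  simp

lemma isProbabilityMeasure_mixture {W : ℕ → ℝ≥0∞} (hW : ∑' m, W m = 1) :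
    IsProbabilityMeasure (mixture W) :=
  ⟨by rw [mixture_univ, hW]⟩

lemma transformDensity_eq (p : ℕ → ℝ) (r : ℂ) :
    transformDensity p r = ∑' m, p m * fockDensity m r := by
  rw [transformDensity, ← tsum_mul_left]
  refine tsum_congr fun m => ?_
  rw [fockDensity, one_div]
  ring

lemma fockDensity_le_one (m : ℕ) (r : ℂ) : fockDensity m r ≤ 1 := by
  have h1 : (‖r‖ ^ 2) ^ m / (m.factorial : ℝ) ≤ Real.exp (‖r‖ ^ 2) :=
    Real.pow_div_factorial_le_exp _ (by positivity) m
  have h2 : Real.pi⁻¹ ≤ 1 := inv_le_one_of_one_le₀ (by linarith [Real.pi_gt_three])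
  calc fockDensity m r
      = Real.pi⁻¹ * (Real.exp (-‖r‖ ^ 2) * ((‖r‖ ^ 2) ^ m / (m.factorial : ℝ))) := by
        rw [fockDensity, pow_mul]
        ring
    _ ≤ 1 * (Real.exp (-‖r‖ ^ 2) * Real.exp (‖r‖ ^ 2)) := by gcongr
    _ = 1 := by rw [← Real.exp_add]; simp

/-- With weights in `ℝ≥0∞`, later exchanges of sums and integrals need no summability conditions. -/
lemma transform_eq_mixture {p : ℕ → ℝ} (hp : IsPMF p) :
    transform p = mixture fun m => ENNReal.ofReal (p m) := by
  have h : (fun r => ENNReal.ofReal (transformDensity p r)) =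
      ∑' m, ENNReal.ofReal (p m) • fun r => ENNReal.ofReal (fockDensity m r) := by
    funext r
    have hs : Summable fun m => p m * fockDensity m r :=
      hp.2.summable.of_nonneg_of_le (fun m => mul_nonneg (hp.1 m) (fockDensity_nonneg m r))
        fun m => mul_le_of_le_one_right (hp.1 m) (fockDensity_le_one m r)
    rw [transformDensity_eq, ENNReal.ofReal_tsum_of_nonneg
      (fun m => mul_nonneg (hp.1 m) (fockDensity_nonneg m r)) hs,
      tsum_apply (Pi.summable.mpr fun _ => ENNReal.summable)]
    refine tsum_congr fun m => ?_
    rw [ENNReal.ofReal_mul (hp.1 m)]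
    rfl
  rw [transform, h, withDensity_tsum fun m => (measurable_ofReal_fockDensity m).const_smul _]
  simp_rw [withDensity_smul _ (measurable_ofReal_fockDensity _)]
  rfl

lemma tsum_ofReal_eq_one {p : ℕ → ℝ} (hp : IsPMF p) : ∑' m, ENNReal.ofReal (p m) = 1 := by
  rw [← ENNReal.ofReal_tsum_of_nonneg hp.1 hp.2.summable, hp.2.tsum_eq, ENNReal.ofReal_one]

lemma isPMF_toReal {W : ℕ → ℝ≥0∞} (hW : ∑' m, W m = 1) : IsPMF fun m => (W m).toReal := by
  refine ⟨fun m => ENNReal.toReal_nonneg, ?_⟩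
  have h := ENNReal.hasSum_toReal (f := W) (by simp [hW])
  rwa [← ENNReal.tsum_toReal_eq, hW, ENNReal.toReal_one] at h
  exact fun m => ne_top_of_le_ne_top ENNReal.one_ne_top (hW ▸ ENNReal.le_tsum m)

lemma mixture_eq_transform {W : ℕ → ℝ≥0∞} (hW : ∑' m, W m = 1) :
    mixture W = transform fun m => (W m).toReal := by
  rw [transform_eq_mixture (isPMF_toReal hW)]
  congr 1
  funext m
  rw [ENNReal.ofReal_toReal]
  exact ne_top_of_le_ne_top ENNReal.one_ne_top (hW ▸ ENNReal.le_tsum m)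

/-! ### The beam splitter: mixtures of Fock laws are stable under normalised addition. -/

/-- The reflection `(x, y) ↦ (c x + s y, s x - c y)` of `ℂ × ℂ`. -/
noncomputable def reflection (c s : ℝ) : ℂ × ℂ →ₗ[ℝ] ℂ × ℂ :=
  (c • LinearMap.fst ℝ ℂ ℂ + s • LinearMap.snd ℝ ℂ ℂ).prod
    (s • LinearMap.fst ℝ ℂ ℂ - c • LinearMap.snd ℝ ℂ ℂ)

lemma reflection_apply (c s : ℝ) (x : ℂ × ℂ) :
    reflection c s x = ((c : ℂ) * x.1 + s * x.2, (s : ℂ) * x.1 - c * x.2) := by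
  simp [reflection]

/-- The map is an involution, so its determinant squares to 1. -/
lemma measurePreserving_reflection {c s : ℝ} (h : c ^ 2 + s ^ 2 = 1) :
    MeasurePreserving (reflection c s) (volume : Measure (ℂ × ℂ)) volume := by
  have h1 : reflection c s ∘ₗ reflection c s = LinearMap.id := by
    have h' : (c : ℂ) ^ 2 + (s : ℂ) ^ 2 = 1 := by exact_mod_cast h
    refine LinearMap.ext fun x => ?_
    rw [LinearMap.comp_apply, reflection_apply, reflection_apply, LinearMap.id_apply]
    refine Prod.ext ?_ ?_
    · simp only
      linear_combination x.1 * h'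
    · simp only
      linear_combination x.2 * h'
  have h2 : LinearMap.det (reflection c s) * LinearMap.det (reflection c s) = 1 := by
    rw [← LinearMap.det_comp, h1, LinearMap.det_id]
  have h3 : |LinearMap.det (reflection c s)| = 1 := by
    rcases mul_self_eq_one_iff.mp h2 with h | h <;> simp [h]
  have : (volume : Measure (ℂ × ℂ)).IsAddHaarMeasure := Measure.prod.instIsAddHaarMeasure _ _
  refine ⟨(LinearMap.continuous_of_finiteDimensional _).measurable, ?_⟩
  rw [Measure.map_linearMap_addHaar_eq_smul_addHaar _ (fun h0 => by simp [h0] at h3), abs_inv, h3]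
  simp

/-- A product of linear forms is a homogeneous polynomial in two variables. -/
lemma exists_coeff_linear_mul (u v : ℝ) {N : ℕ} {F : ℂ → ℂ → ℂ}
    (hF : ∃ d : ℕ → ℝ, ∀ R S, F R S = ∑ k ∈ Finset.range (N + 1), (d k : ℂ) * (R ^ k * S ^ (N - k))) :
    ∃ d : ℕ → ℝ, ∀ R S : ℂ, (u * R + v * S) * F R S =
      ∑ k ∈ Finset.range (N + 1 + 1), (d k : ℂ) * (R ^ k * S ^ (N + 1 - k)) := by
  obtain ⟨d, hd⟩ := hF
  -- The coefficient of R^k is u d_{k-1} + v d_k, with d extended by zero outside 0, …, N.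
  refine ⟨fun k => (if k = 0 then 0 else u * d (k - 1)) + (if k ≤ N then v * d k else 0),
    fun R S => ?_⟩
  simp_rw [Complex.ofReal_add, add_mul, Finset.sum_add_distrib]
  congr 1
  · rw [Finset.sum_range_succ', hd, Finset.mul_sum]
    simp only [Nat.succ_ne_zero, if_false, if_true, Complex.ofReal_zero, zero_mul, add_zero,
      Nat.add_sub_cancel, Nat.add_sub_add_right]
    refine Finset.sum_congr rfl fun k _ => ?_
    push_cast
    ring
  · rw [Finset.sum_range_succ, hd, Finset.mul_sum]
    have h0 : ¬ (N + 1 ≤ N) := by omega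
    simp only [h0, if_false, Complex.ofReal_zero, zero_mul, add_zero]
    refine Finset.sum_congr rfl fun k hk => ?_
    have hk' : k ≤ N := Nat.lt_succ_iff.mp (Finset.mem_range.mp hk)
    rw [if_pos hk', Nat.sub_add_comm hk', pow_succ]
    push_cast
    ring

lemma exists_coeff_linear_pow_mul_linear_pow (u v u' v' : ℝ) (a b : ℕ) :
    ∃ d : ℕ → ℝ, ∀ R S : ℂ, (u * R + v * S) ^ a * (u' * R + v' * S) ^ b =
      ∑ k ∈ Finset.range (a + b + 1), (d k : ℂ) * (R ^ k * S ^ (a + b - k)) := by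
  induction a with
  | zero =>
    induction b with
    | zero => exact ⟨fun _ => 1, fun R S => by simp⟩
    | succ b ih =>
      obtain ⟨d, hd⟩ := exists_coeff_linear_mul u' v' ih
      refine ⟨d, fun R S => ?_⟩
      have := hd R S
      rw [← add_assoc, ← this]
      ring
  | succ a ih =>
    obtain ⟨d, hd⟩ := exists_coeff_linear_mul u v ih
    refine ⟨d, fun R S => ?_⟩
    have := hd R S
    rw [add_right_comm a 1 b, ← this]
    ring

lemma normSq_homogeneous_mul_exp (d : ℕ → ℝ) (N : ℕ) (R S : ℂ) :
    ((‖∑ k ∈ Finset.range (N + 1), (d k : ℂ) * (R ^ k * S ^ (N - k))‖ ^ 2 *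
      Real.exp (-‖S‖ ^ 2) : ℝ) : ℂ) =
    ∑ k ∈ Finset.range (N + 1), ∑ l ∈ Finset.range (N + 1),
      ((d k : ℂ) * R ^ k * (d l * starRingEnd ℂ R ^ l)) * gaussMonomial (N - k) (N - l) S := by
  rw [← Complex.normSq_eq_norm_sq, Complex.ofReal_mul, ← Complex.mul_conj, map_sum,
    Finset.sum_mul_sum, Finset.sum_mul]
  refine Finset.sum_congr rfl fun k _ => ?_
  rw [Finset.sum_mul]
  refine Finset.sum_congr rfl fun l _ => ?_
  simp only [gaussMonomial, map_mul, map_pow, Complex.conj_ofReal]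
  ring

lemma integrable_normSq_homogeneous_mul_exp (d : ℕ → ℝ) (N : ℕ) (R : ℂ) :
    Integrable fun S : ℂ => ‖∑ k ∈ Finset.range (N + 1), (d k : ℂ) * (R ^ k * S ^ (N - k))‖ ^ 2 *
      Real.exp (-‖S‖ ^ 2) := by
  have h : Integrable fun S : ℂ => ((‖∑ k ∈ Finset.range (N + 1),
      (d k : ℂ) * (R ^ k * S ^ (N - k))‖ ^ 2 * Real.exp (-‖S‖ ^ 2) : ℝ) : ℂ) := by
    simp_rw [normSq_homogeneous_mul_exp]
    exact integrable_finsetSum _ fun k _ => integrable_finsetSum _ fun l _ =>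
      (integrable_gaussMonomial _ _).const_mul _
  simpa only [RCLike.re_to_complex, Complex.ofReal_re] using h.re

/-- By homogeneity each power of R comes with its own power of S, and distinct powers of S are
orthogonal. Only squared coefficients survive, so the weights are nonnegative. -/
lemma integral_normSq_homogeneous_mul_exp (d : ℕ → ℝ) (N : ℕ) (R : ℂ) :
    ∫ S : ℂ, ‖∑ k ∈ Finset.range (N + 1), (d k : ℂ) * (R ^ k * S ^ (N - k))‖ ^ 2 *
      Real.exp (-‖S‖ ^ 2) =
    ∑ k ∈ Finset.range (N + 1), d k ^ 2 * ‖R‖ ^ (2 * k) * (Real.pi * (N - k).factorial) := by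
  rw [← Complex.ofReal_inj, ← integral_complex_ofReal]
  simp_rw [normSq_homogeneous_mul_exp]
  rw [integral_finsetSum _ fun k _ => integrable_finsetSum _ fun l _ =>
      (integrable_gaussMonomial _ _).const_mul _]
  rw [Complex.ofReal_sum]
  refine Finset.sum_congr rfl fun k hk => ?_
  have hk' : k ≤ N := Nat.lt_succ_iff.mp (Finset.mem_range.mp hk)
  rw [integral_finsetSum _ fun l _ => (integrable_gaussMonomial _ _).const_mul _,
    Finset.sum_eq_single_of_mem k hk]
  · rw [integral_const_mul, integral_gaussMonomial_self]
    have : R ^ k * starRingEnd ℂ R ^ k = (‖R‖ : ℂ) ^ (2 * k) := by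
      rw [← mul_pow, Complex.mul_conj, Complex.normSq_eq_norm_sq, pow_mul]
      push_cast
      rfl
    push_cast
    rw [← this]
    ring
  · intro l hl hlk
    have hl' : l ≤ N := Nat.lt_succ_iff.mp (Finset.mem_range.mp hl)
    rw [integral_const_mul, integral_gaussMonomial_of_ne (by omega), mul_zero]

/-- The output of a beam splitter fed with two Fock states is a mixture of Fock states. -/
lemma exists_lintegral_fock_fock {c s : ℝ} (h : c ^ 2 + s ^ 2 = 1) (a b : ℕ) :
    ∃ W : ℕ → ℝ≥0∞, ∀ φ : ℂ → ℝ≥0∞, Measurable φ →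
      ∫⁻ x, ∫⁻ y, φ (c * x + s * y) ∂fock b ∂fock a = ∑' k, W k * ∫⁻ r, φ r ∂fock k := by
  obtain ⟨d, hd⟩ := exists_coeff_linear_pow_mul_linear_pow c s s (-c) a b
  set N := a + b with hN
  -- Chosen so that integrating out S leaves exactly w k times `fockDensity k`.
  set w : ℕ → ℝ := fun k => d k ^ 2 * (k.factorial * (N - k).factorial) /
    (a.factorial * b.factorial) with hw
  have hw0 : ∀ k, 0 ≤ w k := fun k => by positivity
  refine ⟨fun k => if k ∈ Finset.range (N + 1) then ENNReal.ofReal (w k) else 0, fun φ hφ => ?_⟩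
  have hprod : ∀ R S : ℂ, fockDensity a (c * R + s * S) * fockDensity b (s * R - c * S) =
      (Real.pi⁻¹ ^ 2 / (a.factorial * b.factorial) * Real.exp (-‖R‖ ^ 2)) *
      (‖∑ k ∈ Finset.range (N + 1), (d k : ℂ) * (R ^ k * S ^ (N - k))‖ ^ 2 *
        Real.exp (-‖S‖ ^ 2)) := by
    intro R S
    have e1 : ‖(c : ℂ) * R + s * S‖ ^ 2 + ‖(s : ℂ) * R - c * S‖ ^ 2 = ‖R‖ ^ 2 + ‖S‖ ^ 2 := by
      simp only [← Complex.normSq_eq_norm_sq, Complex.normSq_apply, Complex.add_re, Complex.add_im,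
        Complex.sub_re, Complex.sub_im, Complex.re_ofReal_mul, Complex.im_ofReal_mul]
      linear_combination (R.re ^ 2 + R.im ^ 2 + S.re ^ 2 + S.im ^ 2) * h
    have e2 : Real.exp (-‖(c : ℂ) * R + s * S‖ ^ 2) * Real.exp (-‖(s : ℂ) * R - c * S‖ ^ 2) =
        Real.exp (-‖R‖ ^ 2) * Real.exp (-‖S‖ ^ 2) := by
      rw [← Real.exp_add, ← Real.exp_add]
      congr 1
      linarith
    have e3 : ‖(c : ℂ) * R + s * S‖ ^ (2 * a) * ‖(s : ℂ) * R - c * S‖ ^ (2 * b) =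
        ‖∑ k ∈ Finset.range (N + 1), (d k : ℂ) * (R ^ k * S ^ (N - k))‖ ^ 2 := by
      rw [← hd R S, norm_mul, norm_pow, norm_pow, mul_pow, ← pow_mul, ← pow_mul, mul_comm 2 a,
        mul_comm 2 b]
      push_cast
      rw [neg_mul, ← sub_eq_add_neg]
    rw [← e3]
    simp only [fockDensity]
    linear_combination (Real.pi⁻¹ ^ 2 / (a.factorial * b.factorial) *
      (‖(c : ℂ) * R + s * S‖ ^ (2 * a) * ‖(s : ℂ) * R - c * S‖ ^ (2 * b))) * e2
  have hinner : ∀ R : ℂ, ∫⁻ S : ℂ, ENNReal.ofReal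
      (fockDensity a (c * R + s * S) * fockDensity b (s * R - c * S)) =
      ∑ k ∈ Finset.range (N + 1), ENNReal.ofReal (w k) * ENNReal.ofReal (fockDensity k R) := by
    intro R
    simp_rw [hprod]
    rw [← ofReal_integral_eq_lintegral_ofReal
      ((integrable_normSq_homogeneous_mul_exp d N R).const_mul _)
      (Eventually.of_forall fun S => by positivity), integral_const_mul,
      integral_normSq_homogeneous_mul_exp]
    simp_rw [← ENNReal.ofReal_mul (hw0 _)]
    rw [← ENNReal.ofReal_sum_of_nonneg fun k _ => mul_nonneg (hw0 k) (fockDensity_nonneg k R),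
      Finset.mul_sum]
    congr 1
    refine Finset.sum_congr rfl fun k _ => ?_
    simp only [hw, fockDensity]
    have := Real.pi_pos.ne'
    have : (k.factorial : ℝ) ≠ 0 := by positivity
    field_simp
  have hca := continuous_fockDensity a
  have hcb := continuous_fockDensity b
  have hlin : Measurable fun z : ℂ × ℂ => (c : ℂ) * z.1 + s * z.2 := by fun_prop
  have hm1 : Measurable fun z : ℂ × ℂ => ENNReal.ofReal (fockDensity a z.1 * fockDensity b z.2) *
      φ (c * z.1 + s * z.2) :=
    (Continuous.measurable (by fun_prop)).ennreal_ofReal.mul (hφ.comp hlin)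
  calc ∫⁻ x, ∫⁻ y, φ (c * x + s * y) ∂fock b ∂fock a
      = ∫⁻ x, ∫⁻ y, ENNReal.ofReal (fockDensity a x * fockDensity b y) * φ (c * x + s * y) := by
        rw [lintegral_fock]
        refine lintegral_congr fun x => ?_
        rw [lintegral_fock, ← lintegral_const_mul' _ _ ENNReal.ofReal_ne_top]
        refine lintegral_congr fun y => ?_
        rw [ENNReal.ofReal_mul (fockDensity_nonneg a x), mul_assoc]
    _ = ∫⁻ z : ℂ × ℂ, ENNReal.ofReal (fockDensity a z.1 * fockDensity b z.2) *
          φ (c * z.1 + s * z.2) := by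
        rw [Measure.volume_eq_prod, lintegral_prod _ hm1.aemeasurable]
    _ = ∫⁻ z : ℂ × ℂ, ENNReal.ofReal (fockDensity a (c * z.1 + s * z.2) *
          fockDensity b (s * z.1 - c * z.2)) * φ z.1 := by
        -- The reflection being its own inverse, the argument of φ becomes the first coordinate.
        rw [← (measurePreserving_reflection h).lintegral_comp hm1]
        refine lintegral_congr fun z => ?_
        rw [reflection_apply]
        simp only
        have h' : (c : ℂ) ^ 2 + (s : ℂ) ^ 2 = 1 := by exact_mod_cast h
        congr 2
        linear_combination z.1 * h'
    _ = ∫⁻ R, ∫⁻ S, ENNReal.ofReal (fockDensity a (c * R + s * S) *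
          fockDensity b (s * R - c * S)) * φ R := by
        rw [Measure.volume_eq_prod, lintegral_prod]
        refine Measurable.aemeasurable ?_
        exact (Continuous.measurable (by fun_prop)).ennreal_ofReal.mul (hφ.comp measurable_fst)
    _ = ∫⁻ R, ∑ k ∈ Finset.range (N + 1),
          ENNReal.ofReal (w k) * (ENNReal.ofReal (fockDensity k R) * φ R) := by
        refine lintegral_congr fun R => ?_
        rw [lintegral_mul_const, hinner, Finset.sum_mul]
        · simp_rw [mul_assoc]
        · exact (Continuous.measurable (by fun_prop)).ennreal_ofReal
    _ = ∑ k ∈ Finset.range (N + 1), ENNReal.ofReal (w k) * ∫⁻ r, φ r ∂fock k := by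
        have hm : ∀ k, Measurable fun R => ENNReal.ofReal (fockDensity k R) * φ R :=
          fun k => (measurable_ofReal_fockDensity k).mul hφ
        rw [lintegral_finsetSum _ fun k _ => (hm k).const_mul _]
        refine Finset.sum_congr rfl fun k _ => ?_
        rw [lintegral_const_mul _ (hm k), lintegral_fock]
    _ = _ := by
        rw [tsum_eq_sum (s := Finset.range (N + 1))]
        · refine Finset.sum_congr rfl fun k hk => ?_
          simp only [if_pos hk]
        · intro k hk
          simp only [if_neg hk, zero_mul]

lemma exists_map_mixture_prod_mixture {c s : ℝ} (h : c ^ 2 + s ^ 2 = 1) {W₁ W₂ : ℕ → ℝ≥0∞}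
    (h₁ : ∑' m, W₁ m = 1) (h₂ : ∑' m, W₂ m = 1) :
    ∃ W : ℕ → ℝ≥0∞, ∑' m, W m = 1 ∧
      ((mixture W₁).prod (mixture W₂)).map (fun z : ℂ × ℂ => (c : ℂ) * z.1 + s * z.2) =
        mixture W := by
  choose C hC using exists_lintegral_fock_fock h
  have hlin : Measurable fun z : ℂ × ℂ => (c : ℂ) * z.1 + s * z.2 := by fun_prop
  have key : ((mixture W₁).prod (mixture W₂)).map (fun z : ℂ × ℂ => (c : ℂ) * z.1 + s * z.2) =
      mixture fun k => ∑' a, ∑' b, W₁ a * W₂ b * C a b k := by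
    refine Measure.ext_of_lintegral _ fun φ hφ => ?_
    have hφl : Measurable fun z : ℂ × ℂ => φ (c * z.1 + s * z.2) := hφ.comp hlin
    rw [lintegral_map hφ hlin, lintegral_prod _ hφl.aemeasurable, lintegral_mixture,
      lintegral_mixture]
    simp_rw [lintegral_mixture W₂]
    have hmeas : ∀ b, Measurable fun x : ℂ => ∫⁻ y, φ (c * x + s * y) ∂fock b := fun b =>
      hφl.lintegral_prod_right'
    have h3 : ∀ a, ∫⁻ x, ∑' b, W₂ b * ∫⁻ y, φ (c * x + s * y) ∂fock b ∂fock a =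
        ∑' b, W₂ b * ∑' k, C a b k * ∫⁻ r, φ r ∂fock k := by
      intro a
      rw [lintegral_tsum fun b => ((hmeas b).const_mul _).aemeasurable]
      refine tsum_congr fun b => ?_
      rw [lintegral_const_mul _ (hmeas b), hC a b φ hφ]
    simp_rw [h3, ← ENNReal.tsum_mul_left, ← ENNReal.tsum_mul_right]
    rw [ENNReal.tsum_comm (f := fun k a => ∑' b, W₁ a * W₂ b * C a b k * ∫⁻ r, φ r ∂fock k)]
    refine tsum_congr fun a => ?_
    rw [ENNReal.tsum_comm (f := fun k b => W₁ a * W₂ b * C a b k * ∫⁻ r, φ r ∂fock k)]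
    simp_rw [mul_assoc]
  refine ⟨_, ?_, key⟩
  have := isProbabilityMeasure_mixture h₁
  have := isProbabilityMeasure_mixture h₂
  -- The weights sum to 1 because their sum is the total mass of a pushforward of a probability
  -- measure.
  rw [← mixture_univ, ← key]
  have := Measure.isProbabilityMeasure_map (μ := (mixture W₁).prod (mixture W₂)) hlin.aemeasurable
  exact measure_univ

/-! ### Characteristic functions and inversion of 𝒯. -/

/-- The exponent is 2i Im(r s*) = i⟪r, 2is⟫. Uniqueness and continuity of `charFun` thereby carry
over. -/
lemma antinormalCharFun_eq_charFun (μ : Measure ℂ) (s : ℂ) :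
    antinormalCharFun μ s = charFun μ (2 * Complex.I * s) := by
  rw [antinormalCharFun, charFun_apply]
  refine integral_congr_ae (Eventually.of_forall fun r => ?_)
  simp only
  congr 1
  apply Complex.ext <;> simp [Complex.inner]
  ring

lemma norm_exp_antinormal (r s : ℂ) :
    ‖Complex.exp (r * starRingEnd ℂ s - starRingEnd ℂ r * s)‖ = 1 := by
  rw [Complex.norm_exp]
  simp [mul_comm]

lemma continuous_exp_antinormal (s : ℂ) :
    Continuous fun r : ℂ => Complex.exp (r * starRingEnd ℂ s - starRingEnd ℂ r * s) := by
  have := Complex.continuous_conj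
  fun_prop

lemma integrable_exp_antinormal (μ : Measure ℂ) [IsFiniteMeasure μ] (s : ℂ) :
    Integrable (fun r : ℂ => Complex.exp (r * starRingEnd ℂ s - starRingEnd ℂ r * s)) μ :=
  Integrable.of_bound (continuous_exp_antinormal s).aestronglyMeasurable 1
    (Eventually.of_forall fun r => (norm_exp_antinormal r s).le)

lemma integral_fock (m : ℕ) (f : ℂ → ℂ) :
    ∫ r, f r ∂fock m = ∫ r, (fockDensity m r : ℂ) * f r := by
  rw [fock, integral_withDensity_eq_integral_toReal_smul (measurable_ofReal_fockDensity m)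
    (Eventually.of_forall fun _ => ENNReal.ofReal_lt_top)]
  simp_rw [ENNReal.toReal_ofReal (fockDensity_nonneg m _), Complex.real_smul]

lemma antinormalCharFun_fock (m : ℕ) (s : ℂ) :
    antinormalCharFun (fock m) s =
      ((laguerre m (‖s‖ ^ 2) * Real.exp (-‖s‖ ^ 2) : ℝ) : ℂ) := by
  rw [antinormalCharFun, integral_fock]
  have h : ∀ r : ℂ, (fockDensity m r : ℂ) *
      Complex.exp (r * starRingEnd ℂ s - starRingEnd ℂ r * s) =
      ((Real.pi : ℂ)⁻¹ / m.factorial) *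
        (Complex.exp (starRingEnd ℂ s * r + (-s) * starRingEnd ℂ r) * gaussMonomial m m r) := by
    intro r
    have h1 : r * starRingEnd ℂ s - starRingEnd ℂ r * s =
        starRingEnd ℂ s * r + (-s) * starRingEnd ℂ r := by ring
    have h2 : r ^ m * starRingEnd ℂ r ^ m = (‖r‖ : ℂ) ^ (2 * m) := by
      rw [← mul_pow, Complex.mul_conj, Complex.normSq_eq_norm_sq, pow_mul]
      push_cast
      rfl
    rw [h1, gaussMonomial, h2, fockDensity]
    push_cast
    ring
  simp_rw [h]
  rw [integral_const_mul, integral_exp_mul_gaussMonomial_self]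
  have h1 : (Real.pi : ℂ) ≠ 0 := by exact_mod_cast Real.pi_pos.ne'
  have h2 : (m.factorial : ℂ) ≠ 0 := by exact_mod_cast m.factorial_ne_zero
  field_simp

lemma isProbabilityMeasure_transform {p : ℕ → ℝ} (hp : IsPMF p) :
    IsProbabilityMeasure (transform p) := by
  rw [transform_eq_mixture hp]
  exact isProbabilityMeasure_mixture (tsum_ofReal_eq_one hp)

lemma hasSum_antinormalCharFun_transform {p : ℕ → ℝ} (hp : IsPMF p) (s : ℂ) :
    HasSum (fun m => ((p m * (laguerre m (‖s‖ ^ 2) * Real.exp (-‖s‖ ^ 2)) : ℝ) : ℂ))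
      (antinormalCharFun (transform p) s) := by
  have := isProbabilityMeasure_transform hp
  have hi := integrable_exp_antinormal (transform p) s
  rw [antinormalCharFun]
  rw [transform_eq_mixture hp, mixture] at hi ⊢
  have h := hasSum_integral_measure hi
  convert! h using 1
  funext m
  rw [integral_smul_measure, ENNReal.toReal_ofReal (hp.1 m), ← antinormalCharFun,
    antinormalCharFun_fock, Complex.real_smul, Complex.ofReal_mul]

/-- This Gaussian reproduces itself when s is replaced by s/√n and the n-th power is taken, hence
dominates for every n ≥ 1. -/
lemma norm_antinormalCharFun_transform_le {p : ℕ → ℝ} (hp : IsPMF p) (s : ℂ) :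
    ‖antinormalCharFun (transform p) s‖ ≤ Real.exp (-(1 / 2) * ‖s‖ ^ 2) := by
  have h := hasSum_antinormalCharFun_transform hp s
  rw [← h.tsum_eq]
  have h2 : HasSum (fun m => p m * Real.exp (-(1 / 2) * ‖s‖ ^ 2))
      (Real.exp (-(1 / 2) * ‖s‖ ^ 2)) := by
    simpa only [one_mul] using hp.2.mul_right (Real.exp (-(1 / 2) * ‖s‖ ^ 2))
  refine tsum_of_norm_bounded h2 fun m => ?_
  rw [Complex.norm_real, Real.norm_eq_abs, abs_mul, abs_mul, abs_of_nonneg (hp.1 m), Real.abs_exp]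
  refine mul_le_mul_of_nonneg_left ?_ (hp.1 m)
  calc _ ≤ Real.exp (‖s‖ ^ 2 / 2) * Real.exp (-‖s‖ ^ 2) := by
        gcongr
        exact abs_laguerre_sq_le m ‖s‖
    _ = _ := by
        rw [← Real.exp_add]
        congr 1
        ring

/-- `𝒯⁻¹` is a left inverse of `𝒯` on probability mass functions. -/
lemma invTransform_transform {p : ℕ → ℝ} (hp : IsPMF p) (n : ℕ) :
    invTransform (transform p) n = p n := by
  set F : ℕ → ℂ → ℂ := fun m s => ((p m * (laguerre m (‖s‖ ^ 2) * laguerre n (‖s‖ ^ 2) *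
    Real.exp (-‖s‖ ^ 2)) : ℝ) : ℂ) with hF
  have hsum : ∀ s, HasSum (fun m => F m s)
      (antinormalCharFun (transform p) s * ((laguerre n (‖s‖ ^ 2) : ℝ) : ℂ)) := by
    intro s
    have h := (hasSum_antinormalCharFun_transform hp s).mul_right
      ((laguerre n (‖s‖ ^ 2) : ℝ) : ℂ)
    convert! h using 1
    funext m
    simp only [hF]
    push_cast
    ring
  have hint : ∀ m, Integrable (F m) := fun m =>
    ((integrable_laguerre_mul_laguerre m n).const_mul (p m)).ofReal
  have hnorm : Summable fun m => ∫ s, ‖F m s‖ := by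
    refine (hp.2.summable.mul_right Real.pi).of_nonneg_of_le
      (fun m => integral_nonneg fun s => norm_nonneg _) fun m => ?_
    simp only [hF, Complex.norm_real, norm_mul (p m), Real.norm_of_nonneg (hp.1 m)]
    rw [integral_const_mul]
    exact mul_le_mul_of_nonneg_left (integral_norm_laguerre_mul_laguerre_le m n) (hp.1 m)
  have h := hasSum_integral_of_summable_integral_norm hint hnorm
  simp_rw [fun s => (hsum s).tsum_eq] at h
  have hval : ∀ m, ∫ s, F m s = if m = n then ((Real.pi * p n : ℝ) : ℂ) else 0 := by
    intro m
    simp only [hF]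
    rw [integral_complex_ofReal, integral_const_mul, integral_laguerre_mul_laguerre]
    split_ifs with hmn
    · rw [hmn, mul_comm]
    · simp
  simp_rw [hval] at h
  have h2 := h.unique (hasSum_ite_eq n _)
  rw [invTransform, h2]
  have hpi := Real.pi_pos.ne'
  have : (1 / Real.pi : ℂ) * ((Real.pi * p n : ℝ) : ℂ) = ((p n : ℝ) : ℂ) := by
    have h1 : (Real.pi : ℂ) ≠ 0 := by exact_mod_cast hpi
    push_cast
    field_simp
  rw [this, Complex.ofReal_re]

lemma antinormalCharFun_map_prod (μ ν : Measure ℂ) [SFinite μ] [SFinite ν] (c d : ℝ) (s : ℂ) :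
    antinormalCharFun ((μ.prod ν).map fun z : ℂ × ℂ => (c : ℂ) * z.1 + d * z.2) s =
      antinormalCharFun μ (c * s) * antinormalCharFun ν (d * s) := by
  rw [antinormalCharFun, integral_map (Measurable.aemeasurable (by fun_prop))
    (continuous_exp_antinormal s).aestronglyMeasurable, antinormalCharFun, antinormalCharFun,
    ← integral_prod_mul]
  refine integral_congr_ae (Eventually.of_forall fun z => ?_)
  simp only
  rw [← Complex.exp_add]
  congr 1
  simp only [map_add, map_mul, Complex.conj_ofReal]
  ring

lemma antinormalCharFun_scaledAddLaw {n : ℕ} (η : Fin n → ℝ) (μ : Fin n → Measure ℂ)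
    [∀ i, SigmaFinite (μ i)] (s : ℂ) :
    antinormalCharFun (scaledAddLaw η μ) s =
      ∏ i, antinormalCharFun (μ i) (Real.sqrt (η i) * s) := by
  simp only [antinormalCharFun, scaledAddLaw]
  rw [integral_map (Measurable.aemeasurable (by fun_prop))
    (continuous_exp_antinormal s).aestronglyMeasurable, ← integral_fintype_prod_eq_prod]
  refine integral_congr_ae (Eventually.of_forall fun z => ?_)
  simp only
  rw [← Complex.exp_sum]
  congr 1
  simp only [map_sum, map_mul, Complex.conj_ofReal, Finset.sum_mul, ← Finset.sum_sub_distrib]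
  refine Finset.sum_congr rfl fun i _ => ?_
  ring

lemma isProbabilityMeasure_scaledAddLaw {n : ℕ} (η : Fin n → ℝ) (μ : Fin n → Measure ℂ)
    [∀ i, IsProbabilityMeasure (μ i)] : IsProbabilityMeasure (scaledAddLaw η μ) :=
  Measure.isProbabilityMeasure_map (Measurable.aemeasurable (by fun_prop))

lemma ext_of_antinormalCharFun {μ ν : Measure ℂ} [IsFiniteMeasure μ] [IsFiniteMeasure ν]
    (h : ∀ s, antinormalCharFun μ s = antinormalCharFun ν s) : μ = ν := by
  refine Measure.ext_of_charFun (funext fun t => ?_)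
  have h1 := h ((2 * Complex.I)⁻¹ * t)
  rw [antinormalCharFun_eq_charFun, antinormalCharFun_eq_charFun] at h1
  rwa [mul_inv_cancel_left₀ (by simp)] at h1

/-- The normalised sum of `n` independent variables of law `𝒯(p)` has law `𝒯(w)` for some
probability mass function `w`. -/
lemma exists_transform_charFun_eq_pow {p : ℕ → ℝ} (hp : IsPMF p) {n : ℕ} (hn : 1 ≤ n) :
    ∃ W : ℕ → ℝ≥0∞, ∑' m, W m = 1 ∧ ∀ s, antinormalCharFun (mixture W) s =
      antinormalCharFun (transform p) (Real.sqrt (1 / n) * s) ^ n := by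
  induction n, hn using Nat.le_induction with
  | base =>
    refine ⟨fun m => ENNReal.ofReal (p m), tsum_ofReal_eq_one hp, fun s => ?_⟩
    rw [← transform_eq_mixture hp]
    simp
  | succ n hn ih =>
    obtain ⟨W, hW, hWs⟩ := ih
    have hn0 : (0 : ℝ) < n := by exact_mod_cast hn
    -- The normalised sum of n + 1 terms is √(n/(n+1)) times that of n terms plus √(1/(n+1)) times a
    -- fresh one: one more beam splitter.
    have hcs : Real.sqrt (n / (n + 1)) ^ 2 + Real.sqrt (1 / (n + 1)) ^ 2 = 1 := by
      rw [Real.sq_sqrt (by positivity), Real.sq_sqrt (by positivity)]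
      field_simp
    obtain ⟨V, hV, hVm⟩ := exists_map_mixture_prod_mixture hcs hW (tsum_ofReal_eq_one hp)
    refine ⟨V, hV, fun s => ?_⟩
    rw [← hVm, antinormalCharFun_map_prod, hWs, ← transform_eq_mixture hp, pow_succ]
    have h1 : Real.sqrt (1 / n) * Real.sqrt (n / (n + 1)) = Real.sqrt (1 / (n + 1)) := by
      rw [← Real.sqrt_mul (by positivity)]
      congr 1
      field_simp
    rw [← mul_assoc, ← Complex.ofReal_mul, h1]
    push_cast
    rfl

lemma antinormalCharFun_scaledAddLaw_transform {p : ℕ → ℝ} (hp : IsPMF p) (n : ℕ) (s : ℂ) :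
    antinormalCharFun (scaledAddLaw (fun _ : Fin n => (1 / n : ℝ)) fun _ => transform p) s =
      antinormalCharFun (transform p) (Real.sqrt (1 / n) * s) ^ n := by
  have := isProbabilityMeasure_transform hp
  rw [antinormalCharFun_scaledAddLaw, Finset.prod_const, Finset.card_univ, Fintype.card_fin]

lemma exists_pmf_transform_eq_scaledAddLaw {p : ℕ → ℝ} (hp : IsPMF p) {n : ℕ} (hn : 1 ≤ n) :
    ∃ w : ℕ → ℝ, IsPMF w ∧
      transform w = scaledAddLaw (fun _ : Fin n => (1 / n : ℝ)) fun _ => transform p := by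
  obtain ⟨W, hW, hWs⟩ := exists_transform_charFun_eq_pow hp hn
  refine ⟨_, isPMF_toReal hW, ?_⟩
  rw [← mixture_eq_transform hW]
  have := isProbabilityMeasure_transform hp
  have := isProbabilityMeasure_mixture hW
  have := isProbabilityMeasure_scaledAddLaw (fun _ : Fin n => (1 / n : ℝ)) fun _ => transform p
  refine ext_of_antinormalCharFun fun s => ?_
  rw [hWs, antinormalCharFun_scaledAddLaw_transform hp]

/-! ### Moments of 𝒯(p) and the central limit theorem. -/

/-- Multiplying by |r|² turns the m-th density into m + 1 times the (m+1)-st. -/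
lemma lintegral_normSq_fock (m : ℕ) :
    ∫⁻ r, ENNReal.ofReal (‖r‖ ^ 2) ∂fock m = m + 1 := by
  have h : ∀ r : ℂ, ENNReal.ofReal (fockDensity m r) * ENNReal.ofReal (‖r‖ ^ 2) =
      ENNReal.ofReal ((m : ℝ) + 1) * ENNReal.ofReal (fockDensity (m + 1) r) := by
    intro r
    rw [← ENNReal.ofReal_mul (fockDensity_nonneg m r), ← ENNReal.ofReal_mul (by positivity)]
    congr 1
    simp only [fockDensity, Nat.factorial_succ, mul_add, pow_add]
    push_cast
    field_simp
  rw [lintegral_fock]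
  simp_rw [h]
  rw [lintegral_const_mul _ (measurable_ofReal_fockDensity _)]
  have h1 := lintegral_fock (m + 1) 1
  simp only [Pi.one_apply, mul_one, lintegral_one, measure_univ] at h1
  rw [← h1, mul_one, ENNReal.ofReal_add (by positivity) zero_le_one]
  simp

lemma lintegral_normSq_transform {p : ℕ → ℝ} (hp : IsPMF p) :
    ∫⁻ r, ENNReal.ofReal (‖r‖ ^ 2) ∂transform p = ∑' m, ENNReal.ofReal (p m) * m + 1 := by
  rw [transform_eq_mixture hp, lintegral_mixture]
  simp_rw [lintegral_normSq_fock, mul_add, mul_one]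
  rw [ENNReal.tsum_add, tsum_ofReal_eq_one hp]

/-- The law `𝒯(p)` is circularly symmetric. -/
lemma measurePreserving_rotation_transform {p : ℕ → ℝ} (hp : IsPMF p) (u : Circle) :
    MeasurePreserving (rotation u) (transform p) (transform p) := by
  have hm : Measurable (rotation u) := (rotation u).continuous.measurable
  refine ⟨hm, Measure.ext_of_lintegral _ fun φ hφ => ?_⟩
  rw [lintegral_map hφ hm, transform_eq_mixture hp, lintegral_mixture, lintegral_mixture]
  refine tsum_congr fun m => ?_
  congr 1
  have hm' : Measurable fun r => ENNReal.ofReal (fockDensity m r) * φ r :=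
    (measurable_ofReal_fockDensity m).mul hφ
  rw [lintegral_fock, lintegral_fock,
    ← (LinearIsometryEquiv.measurePreserving (rotation u)).lintegral_comp hm']
  refine lintegral_congr fun r => ?_
  have : fockDensity m (rotation u r) = fockDensity m r := by
    simp only [fockDensity, LinearIsometryEquiv.norm_map]
  simp only [this]

lemma integral_comp_rotation_transform {p : ℕ → ℝ} (hp : IsPMF p) (u : Circle) (f : ℂ → ℝ) :
    ∫ r, f (u * r) ∂transform p = ∫ r, f r ∂transform p := by
  have := (measurePreserving_rotation_transform hp u).integral_comp
    (rotation u).toHomeomorph.measurableEmbedding f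
  simpa only [rotation_apply] using this

lemma integral_inner_transform {p : ℕ → ℝ} (hp : IsPMF p) (t : ℂ) :
    ∫ r, ⟪r, t⟫ ∂transform p = 0 := by
  have h := integral_comp_rotation_transform hp (Circle.exp Real.pi) fun r => ⟪r, t⟫
  simp only [Circle.coe_exp, Complex.exp_pi_mul_I, neg_one_mul, inner_neg_left] at h
  rw [integral_neg] at h
  linarith

lemma integral_normSq_transform {p : ℕ → ℝ} (hp : IsPMF p) {lam : ℝ} (hlam : 0 ≤ lam)
    (h : ∑' m, ENNReal.ofReal (p m) * m = ENNReal.ofReal lam) :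
    Integrable (fun r : ℂ => ‖r‖ ^ 2) (transform p) ∧
      ∫ r, ‖r‖ ^ 2 ∂transform p = 1 + lam := by
  have h1 := lintegral_normSq_transform hp
  rw [h] at h1
  have hc : Continuous fun r : ℂ => ‖r‖ ^ 2 := by fun_prop
  constructor
  · refine ⟨hc.aestronglyMeasurable, ?_⟩
    rw [hasFiniteIntegral_iff_ofReal (Eventually.of_forall fun r => by positivity), h1]
    exact ENNReal.add_lt_top.mpr ⟨ENNReal.ofReal_lt_top, ENNReal.one_lt_top⟩
  · rw [integral_eq_lintegral_of_nonneg_ae (Eventually.of_forall fun r => by positivity)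
      hc.aestronglyMeasurable, h1, ENNReal.toReal_add ENNReal.ofReal_ne_top ENNReal.one_ne_top,
      ENNReal.toReal_ofReal hlam, ENNReal.toReal_one, add_comm]

/-- Rotation by π/2 preserves the law, and ⟪ir, t⟫² + ⟪r, t⟫² = |t|²|r|², so each square carries
half of the second moment. -/
lemma integral_inner_sq_transform {p : ℕ → ℝ} (hp : IsPMF p) {lam : ℝ} (hlam : 0 ≤ lam)
    (h : ∑' m, ENNReal.ofReal (p m) * m = ENNReal.ofReal lam) (t : ℂ) :
    ∫ r, ⟪r, t⟫ ^ 2 ∂transform p = ‖t‖ ^ 2 * (1 + lam) / 2 := by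
  obtain ⟨hi, hv⟩ := integral_normSq_transform hp hlam h
  have hrot := integral_comp_rotation_transform hp (Circle.exp (Real.pi / 2)) fun r => ⟪r, t⟫ ^ 2
  have hI : ((Circle.exp (Real.pi / 2) : Circle) : ℂ) = Complex.I := by
    rw [Circle.coe_exp]
    push_cast
    exact Complex.exp_pi_div_two_mul_I
  rw [hI] at hrot
  have hsum : ∀ r : ℂ, ⟪Complex.I * r, t⟫ ^ 2 + ⟪r, t⟫ ^ 2 = ‖t‖ ^ 2 * ‖r‖ ^ 2 := by
    intro r
    rw [← Complex.normSq_eq_norm_sq, ← Complex.normSq_eq_norm_sq, Complex.normSq_apply,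
      Complex.normSq_apply]
    simp [Complex.inner]
    ring
  have hint : ∀ v : ℂ, ‖v‖ ≤ 1 → Integrable (fun r : ℂ => ⟪v * r, t⟫ ^ 2) (transform p) := by
    intro v hv
    refine (hi.const_mul (‖t‖ ^ 2)).mono'
      (Continuous.aestronglyMeasurable (by fun_prop)) (Eventually.of_forall fun r => ?_)
    rw [Real.norm_of_nonneg (by positivity), ← sq_abs, ← mul_pow]
    gcongr
    refine (abs_real_inner_le_norm _ _).trans ?_
    rw [norm_mul, mul_comm]
    gcongr
    exact mul_le_of_le_one_left (norm_nonneg _) hv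
  have h1 := integral_add (hint Complex.I (by simp)) (hint 1 (by simp))
  simp only [one_mul, hsum, integral_const_mul, hv, hrot] at h1
  linarith

/-- The central limit theorem for `𝒯(p)`, in terms of characteristic functions. -/
lemma tendsto_antinormalCharFun_pow {p : ℕ → ℝ} (hp : IsPMF p) {lam : ℝ} (hlam : 0 ≤ lam)
    (h : ∑' m, ENNReal.ofReal (p m) * m = ENNReal.ofReal lam) (s : ℂ) :
    Tendsto (fun n : ℕ => antinormalCharFun (transform p) (Real.sqrt (1 / n) * s) ^ n) atTop
      (𝓝 ((Real.exp (-(1 + lam) * ‖s‖ ^ 2) : ℝ) : ℂ)) := by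
  have hprob := isProbabilityMeasure_transform hp
  rcases eq_or_ne s 0 with rfl | hs
  · have : antinormalCharFun (transform p) 0 = 1 := by simp [antinormalCharFun]
    simp [this]
  set t : ℂ := 2 * Complex.I * s with ht
  have htn : ‖t‖ = 2 * ‖s‖ := by simp [ht]
  -- The variance of ⟪R, t⟫. The one-dimensional theorem is applied to the standardised projection X
  -- and evaluated at √v, which gives e^{-v/2}.
  set v : ℝ := 2 * ‖s‖ ^ 2 * (1 + lam) with hv
  have hs' : 0 < ‖s‖ := norm_pos_iff.mpr hs
  have hv0 : 0 < v := by positivity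
  have hsv : 0 < Real.sqrt v := Real.sqrt_pos.mpr hv0
  set X : ℂ → ℝ := fun r => (Real.sqrt v)⁻¹ * ⟪r, t⟫ with hX
  have hXm : Measurable X := Continuous.measurable (by fun_prop)
  have h0 : ∫ r, X r ∂transform p = 0 := by
    rw [integral_const_mul, integral_inner_transform hp, mul_zero]
  have h1 : ∫ r, (X ^ 2) r ∂transform p = 1 := by
    simp only [Pi.pow_apply, hX, mul_pow]
    rw [integral_const_mul, integral_inner_sq_transform hp hlam h, htn, inv_pow,
      Real.sq_sqrt hv0.le, hv]
    field_simp
  have key := tendsto_charFun_inv_sqrt_mul_pow hXm.aemeasurable h0 h1 (Real.sqrt v)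
  have hlim : Complex.exp (-(Real.sqrt v : ℂ) ^ 2 / 2) =
      ((Real.exp (-(1 + lam) * ‖s‖ ^ 2) : ℝ) : ℂ) := by
    rw [← Complex.ofReal_pow, Real.sq_sqrt hv0.le, hv, Complex.ofReal_exp]
    congr 1
    push_cast
    ring
  rw [hlim] at key
  refine key.congr fun n => ?_
  congr 1
  rw [antinormalCharFun_eq_charFun, charFun_apply, charFun_apply,
    integral_map hXm.aemeasurable (Continuous.aestronglyMeasurable (by fun_prop))]
  refine integral_congr_ae (Eventually.of_forall fun r => ?_)
  simp only
  have : 2 * Complex.I * (Real.sqrt (1 / n) * s) = Real.sqrt (1 / n) • t := by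
    rw [Complex.real_smul, ht]
    ring
  rw [this, inner_smul_right, one_div, Real.sqrt_inv]
  congr 2
  rw [hX]
  simp only [RCLike.inner_apply, conj_trivial]
  field_simp

/-! ### Passing to the limit under 𝒯⁻¹. -/

lemma integrable_laguerre_mul_exp (k : ℕ) {c : ℝ} (hc : 0 < c) :
    Integrable fun s : ℂ => laguerre k (‖s‖ ^ 2) * Real.exp (-c * ‖s‖ ^ 2) := by
  simp_rw [laguerre, Finset.sum_mul]
  refine integrable_finsetSum _ fun j _ => ?_
  refine ((integrable_norm_pow_mul_exp (2 * j) hc).const_mul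
    ((-1) ^ j * k.choose j / j.factorial)).congr (Eventually.of_forall fun s => ?_)
  simp only [pow_mul]
  ring

/-- Termwise this is π(1+λ)⁻¹ ∑ⱼ (k choose j)(-(1+λ)⁻¹)ʲ, a binomial expansion of (1 - (1+λ)⁻¹)ᵏ. -/
lemma integral_laguerre_mul_exp (k : ℕ) {lam : ℝ} (hlam : 0 ≤ lam) :
    ∫ s : ℂ, laguerre k (‖s‖ ^ 2) * Real.exp (-(1 + lam) * ‖s‖ ^ 2) =
      Real.pi * geometricPMF lam k := by
  have hc : 0 < 1 + lam := by linarith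
  have h : ∀ s : ℂ, laguerre k (‖s‖ ^ 2) * Real.exp (-(1 + lam) * ‖s‖ ^ 2) =
      ∑ j ∈ Finset.range (k + 1), ((-1) ^ j * k.choose j / j.factorial) *
        (‖s‖ ^ (2 * j) * Real.exp (-(1 + lam) * ‖s‖ ^ 2)) := by
    intro s
    rw [laguerre, Finset.sum_mul]
    refine Finset.sum_congr rfl fun j _ => ?_
    rw [pow_mul]
    ring
  simp_rw [h]
  rw [integral_finsetSum _ fun j _ => (integrable_norm_pow_mul_exp (2 * j) hc).const_mul _]
  simp_rw [integral_const_mul, integral_norm_even_pow_mul_exp _ hc]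
  have h1 : lam / (1 + lam) = -(1 + lam)⁻¹ + 1 := by field_simp; ring
  rw [geometricPMF, h1, add_pow, Finset.mul_sum, Finset.mul_sum]
  refine Finset.sum_congr rfl fun j _ => ?_
  have : (j.factorial : ℝ) ≠ 0 := by positivity
  rw [neg_pow (1 + lam)⁻¹, inv_pow, pow_succ]
  field_simp
  simp

lemma tendsto_invTransform_scaledAddLaw {p : ℕ → ℝ} (hp : IsPMF p) {lam : ℝ} (hlam : 0 ≤ lam)
    (h : ∑' m, ENNReal.ofReal (p m) * m = ENNReal.ofReal lam) (k : ℕ) :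
    Tendsto (fun n : ℕ => invTransform
      (scaledAddLaw (fun _ : Fin n => (1 / n : ℝ)) fun _ => transform p) k) atTop
      (𝓝 (geometricPMF lam k)) := by
  have hprob := isProbabilityMeasure_transform hp
  have hint : Tendsto (fun n : ℕ => ∫ s : ℂ, antinormalCharFun (scaledAddLaw
        (fun _ : Fin n => (1 / n : ℝ)) fun _ => transform p) s *
        ((laguerre k (‖s‖ ^ 2) : ℝ) : ℂ)) atTop
      (𝓝 (∫ s : ℂ, ((Real.exp (-(1 + lam) * ‖s‖ ^ 2) : ℝ) : ℂ) *
        ((laguerre k (‖s‖ ^ 2) : ℝ) : ℂ))) := by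
    have hL : Continuous fun s : ℂ => ((laguerre k (‖s‖ ^ 2) : ℝ) : ℂ) := by
      unfold laguerre
      fun_prop
    have hcf : Continuous (antinormalCharFun (transform p)) := by
      simp_rw [funext (antinormalCharFun_eq_charFun (transform p))]
      exact continuous_charFun.comp (by fun_prop)
    refine tendsto_integral_filter_of_dominated_convergence
      (fun s => ‖laguerre k (‖s‖ ^ 2) * Real.exp (-(1 / 2) * ‖s‖ ^ 2)‖)
      (Eventually.of_forall fun n => ?_) ?_
      (integrable_laguerre_mul_exp k (by norm_num)).norm (Eventually.of_forall fun s => ?_)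
    · simp_rw [antinormalCharFun_scaledAddLaw_transform hp]
      exact Continuous.aestronglyMeasurable (by fun_prop)
    -- For n = 0 the characteristic function is constantly 1 and is not dominated.
    · filter_upwards [eventually_ge_atTop 1] with n hn
      refine Eventually.of_forall fun s => ?_
      have hn0 : (0 : ℝ) < n := by exact_mod_cast hn
      rw [antinormalCharFun_scaledAddLaw_transform hp, norm_mul, norm_mul, norm_pow, mul_comm,
        Complex.norm_real, Real.norm_eq_abs (Real.exp _), Real.abs_exp]
      gcongr
      calc _ ≤ Real.exp (-(1 / 2) * ‖(Real.sqrt (1 / n) : ℂ) * s‖ ^ 2) ^ n := by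
            gcongr
            exact norm_antinormalCharFun_transform_le hp _
        _ = _ := by
            rw [← Real.exp_nat_mul, norm_mul, mul_pow, Complex.norm_real, Real.norm_eq_abs, sq_abs,
              Real.sq_sqrt (by positivity)]
            congr 1
            field_simp
    · simp_rw [antinormalCharFun_scaledAddLaw_transform hp]
      exact (tendsto_antinormalCharFun_pow hp hlam h s).mul_const _
  have hre := (Complex.continuous_re.tendsto _).comp (hint.const_mul (1 / Real.pi : ℂ))
  have hval : ((1 / Real.pi : ℂ) * ∫ s : ℂ, ((Real.exp (-(1 + lam) * ‖s‖ ^ 2) : ℝ) : ℂ) *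
      ((laguerre k (‖s‖ ^ 2) : ℝ) : ℂ)).re = geometricPMF lam k := by
    simp_rw [← Complex.ofReal_mul]
    rw [integral_complex_ofReal]
    simp_rw [mul_comm (Real.exp _)]
    rw [integral_laguerre_mul_exp k hlam, ← Complex.ofReal_one, ← Complex.ofReal_div,
      ← Complex.ofReal_mul, Complex.ofReal_re]
    have := Real.pi_pos.ne'
    field_simp
  rw [hval] at hre
  exact hre

/-! ### From random variables to p.m.f.s, and the main theorem. -/

lemma ofReal_pmfOf {Ω : Type*} [MeasurableSpace Ω] (P : Measure Ω) [IsProbabilityMeasure P]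
    {X : Ω → ℕ} (hX : Measurable X) (k : ℕ) : ENNReal.ofReal (pmfOf P X k) = P.map X {k} := by
  rw [pmfOf, ofReal_measureReal, Measure.map_apply hX (measurableSet_singleton k)]

lemma tsum_ofReal_pmfOf_mul {Ω : Type*} [MeasurableSpace Ω] (P : Measure Ω)
    [IsProbabilityMeasure P] {X : Ω → ℕ} (hX : Measurable X) (f : ℕ → ℝ≥0∞) :
    ∑' k, ENNReal.ofReal (pmfOf P X k) * f k = ∫⁻ ω, f (X ω) ∂P := by
  rw [← lintegral_map (measurable_of_countable f) hX, lintegral_countable']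
  simp_rw [ofReal_pmfOf P hX, mul_comm]

lemma isPMF_pmfOf {Ω : Type*} [MeasurableSpace Ω] (P : Measure Ω) [IsProbabilityMeasure P]
    {X : Ω → ℕ} (hX : Measurable X) : IsPMF (pmfOf P X) := by
  have h := tsum_ofReal_pmfOf_mul P hX 1
  simp only [Pi.one_apply, mul_one, lintegral_one, measure_univ] at h
  have h2 := isPMF_toReal h
  have h3 : ∀ k, 0 ≤ pmfOf P X k := fun k => measureReal_nonneg
  simpa only [ENNReal.toReal_ofReal (h3 _)] using h2

end DiscreteEPI

theorem mainTheorem3 {Ω : Type*} [MeasurableSpace Ω] (P : Measure Ω) [IsProbabilityMeasure P]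
    (X : ℕ → Ω → ℕ) (hmeas : ∀ i, Measurable (X i)) (hindep : iIndepFun X P)
    (hident : ∀ i, IdentDistrib (X i) (X 0) P P)
    (lam : ℝ) (hint : Integrable (fun ω => (X 0 ω : ℝ)) P)
    (hmean : ∫ ω, (X 0 ω : ℝ) ∂P = lam) :
    -- the scaled addition of `X 0, …, X (n - 1)` is a bona fide random variable on `ℕ₀`,
    -- whose transform is the scaled sum of the transforms
    (∀ n : ℕ, 1 ≤ n →
      DiscreteEPI.IsPMF
        (DiscreteEPI.scaledAdd (fun _ : Fin n => (1 / n : ℝ))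
          (fun i => DiscreteEPI.pmfOf P (X i))) ∧
      DiscreteEPI.transform
        (DiscreteEPI.scaledAdd (fun _ : Fin n => (1 / n : ℝ))
          (fun i => DiscreteEPI.pmfOf P (X i))) =
        DiscreteEPI.scaledAddLaw (fun _ : Fin n => (1 / n : ℝ))
          (fun i => DiscreteEPI.transform (DiscreteEPI.pmfOf P (X i)))) ∧
    -- its probability mass function converges to the geometric one with the same mean
    (∀ k : ℕ, Tendsto
      (fun n : ℕ => DiscreteEPI.scaledAdd (fun _ : Fin n => (1 / n : ℝ))
        (fun i => DiscreteEPI.pmfOf P (X i)) k)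
      atTop (𝓝 (DiscreteEPI.geometricPMF lam k))) := by
  have hpX : ∀ i, DiscreteEPI.pmfOf P (X i) = DiscreteEPI.pmfOf P (X 0) := fun i => by
    funext k
    simp only [DiscreteEPI.pmfOf, measureReal_def,
      (hident i).measure_mem_eq (measurableSet_singleton k)]
  have hp := DiscreteEPI.isPMF_pmfOf P (hmeas 0)
  have hlam : 0 ≤ lam := hmean ▸ integral_nonneg fun ω => Nat.cast_nonneg _
  have hsum : ∑' m, ENNReal.ofReal (DiscreteEPI.pmfOf P (X 0) m) * (m : ENNReal) =
      ENNReal.ofReal lam := by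
    rw [DiscreteEPI.tsum_ofReal_pmfOf_mul P (hmeas 0) fun m => (m : ENNReal), ← hmean,
      ofReal_integral_eq_lintegral_ofReal hint (Eventually.of_forall fun ω => Nat.cast_nonneg _)]
    simp
  simp only [hpX]
  refine ⟨fun n hn => ?_, DiscreteEPI.tendsto_invTransform_scaledAddLaw hp hlam hsum⟩
  obtain ⟨w, hw, hwt⟩ := DiscreteEPI.exists_pmf_transform_eq_scaledAddLaw hp hn
  -- The law of the sum is known to be 𝒯(w), so applying 𝒯⁻¹ returns w itself.
  have hq : DiscreteEPI.scaledAdd (fun _ : Fin n => (1 / n : ℝ))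
      (fun _ => DiscreteEPI.pmfOf P (X 0)) = w := by
    funext k
    rw [DiscreteEPI.scaledAdd, ← hwt, DiscreteEPI.invTransform_transform hw]
  rw [hq]
  exact ⟨hw, hwt⟩
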